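/- Let $h$ denote the absolute logarithmic Weil height on $\overline{\mathbb Q}$. Let $S=(\mathbb Q(T),(\Omega,\mathcal A,\nu),\phi)$ be the following adelic curve. The set $\Omega$ is the disjoint union of - the set $\Omega_h$ of closed points $x$ of $\mathbb P^1_{\mathbb Q}\setminus\{\infty\}$, with $|\varphi|_x=H(x)^{-\mathrm{ord}_x(\varphi)}$ for $\varphi\neq 0$, where $F_x\in\mathbb Z[T]$ is the irreducible polynomial with coprime coefficients vanishing at $x$ (unique up to sign) and $H(x)=\exp\bigl(\int_0^1\log|F_x(e^{2\pi it})|\,dt\bigr)$ is its Mahler measure; - the set $\mathcal P$ of prime numbers $p$, with $|\sum_j a_jT^j|_p=\max_j|a_j|_p$ on $\mathbb Q[T]$, extended multiplicatively to $\mathbb Q(T)$; - the set $[0,1]_*$ of all $t\in[0,1]$ such that $e^{2\pi it}$ is transcendental, with $|\varphi|_t=|\varphi(e^{2\pi it})|$. The measure $\nu$ gives mass $1$ to every point of $\Omega_h$ and of $\mathcal P$ (with the discrete $\sigma$-algebras) and is Lebesgue measure on $[0,1]_*$ (with the Borel $\sigma$-algebra). For $\alpha\in\overline{\mathbb Q(T)}$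 and $K'=\mathbb Q(T)(\alpha)$, the height of $\alpha$ with respect to $S$ is $$h_S(\alpha)=\int_\Omega\ \sum_{w\mid\omega}\frac{[K'_w:\mathbb Q(T)_\omega]}{[K':\mathbb Q(T)]}\,\log\max(1,|\alpha|_w)\ \nu(d\omega),$$ where $w$ runs over the absolute values of $K'$ whose restriction to $\mathbb Q(T)$ is $|\cdot|_\omega$, and $K'_w$, $\mathbb Q(T)_\omega$ are the completions. **Theorem.** The following two statements are equivalent. 1. (Lehmer's problem) There is a real number $c>0$ such that $h(\alpha)\ge \dfrac{c}{[\mathbb Q(\alpha):\mathbb Q]}$ for every $\alpha\in\overline{\mathbb Q}\setminus\{0\}$ that is not a root of unity. 2. (Lehmer's problem on $\mathbb Q(T)$) There is a real number $c>0$ such that $h_S(\alpha)\ge\dfrac{c}{[\mathbb Q(T)(\alpha):\mathbb Q(T)]}$ for every $\alpha\in\overline{\mathbb Q(T)}$ with $h_S(\alpha)>0$. -/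

import Mathlib

open Polynomial IntermediateField MeasureTheory

noncomputable section

namespace AdelicQT

/-! ### Heights over a finite extension, fibre by fibre -/

/-- The canonical embedding of a field `L` in its completion for the absolute value `w`. -/
def toCompletion {L : Type*} [Field L] (w : AbsoluteValue L ℝ) : L →+* w.Completion :=
  (UniformSpace.Completion.coeRingHom (α := WithAbs w)).comp
    (WithAbs.equiv w).symm.toRingHom

/-- The local degree `[L_w : K_v]`, where `v` is the restriction of `w` to `K`. The completion
`K_v` is realised as the topological closure of `K` in the completion `L_w`. -/
def localDegree (K : Type*) {L : Type*} [Field K] [Field L] [Algebra K L]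
    (w : AbsoluteValue L ℝ) : ℕ :=
  Module.finrank ((toCompletion w).comp (algebraMap K L)).fieldRange.topologicalClosure
    w.Completion

/-- For a finite extension `L / K`, an absolute value `v` of `K`, and a function `f` of the
absolute values of `L`: the fibre average
`∑_{w ∣ v} ([L_w : K_v] / [L : K]) * f w`, over the (finitely many) absolute values `w` of `L`
whose restriction to `K` is equal to `v`. -/
def fiberAverage {K L : Type*} [Field K] [Field L] [Algebra K L] (v : AbsoluteValue K ℝ)
    (f : AbsoluteValue L ℝ → ℝ) : ℝ :=
  ∑ᶠ w : {w : AbsoluteValue L ℝ // w.LiesOver v},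
    (localDegree K w.1 : ℝ) / (Module.finrank K L : ℝ) * f w.1

/-! ### The three families of absolute values of `ℚ(T)` -/

/-- The closed points of `ℙ¹_ℚ` other than `∞`, that is, the closed points of the affine line
`Spec ℚ[T]`. -/
def ClosedPoint : Type := IsDedekindDomain.HeightOneSpectrum ℚ[X]

/-- The set of all prime numbers. -/
def PrimeNumber : Type := {p : ℕ // p.Prime}

/-- The set of all `t ∈ [0, 1]` such that `exp (2 π i t)` is transcendental. -/
abbrev TranscendentalAngle : Type :=
  {t : ℝ // t ∈ Set.Icc (0 : ℝ) 1 ∧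
    Transcendental ℚ (Complex.exp (2 * Real.pi * Complex.I * (t : ℂ)))}

/-- Every closed point `x` of the affine line over `ℚ` is the zero of an irreducible polynomial
with integer coefficients (irreducible in `ℤ[T]`, hence with coprime coefficients). -/
theorem ClosedPoint.exists_intPoly (x : ClosedPoint) :
    ∃ F : ℤ[X], Irreducible F ∧ Ideal.span {F.map (Int.castRingHom ℚ)} = x.asIdeal := by
  obtain ⟨f, hf⟩ := (IsPrincipalIdealRing.principal x.asIdeal).principal
  have hf' : x.asIdeal = Ideal.span {f} := hf
  have hf0 : f ≠ 0 := by
    rintro rfl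
    exact x.ne_bot (by rw [hf']; simp)
  have hfp : Prime f := (Ideal.span_singleton_prime hf0).1 (hf' ▸ x.isPrime)
  obtain ⟨b, hb, hbf⟩ := IsLocalization.integerNormalization_spec (nonZeroDivisors ℤ) f
  set G : ℤ[X] := IsLocalization.integerNormalization (nonZeroDivisors ℤ) f with hG
  have hGf : G.map (Int.castRingHom ℚ) = C (b : ℚ) * f := by
    ext i
    have h := congrArg (fun P : ℚ[X] => P.coeff i) hbf
    simpa using h
  have hb0 : (b : ℚ) ≠ 0 := by exact_mod_cast nonZeroDivisors.ne_zero hb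
  have hG0 : G ≠ 0 := by
    intro h
    rw [h, Polynomial.map_zero] at hGf
    exact mul_ne_zero (C_ne_zero.2 hb0) hf0 hGf.symm
  have hc0 : (G.content : ℚ) ≠ 0 := by
    exact_mod_cast mt content_eq_zero_iff.1 hG0
  have hPG : C (G.content : ℚ) * G.primPart.map (Int.castRingHom ℚ) = C (b : ℚ) * f := by
    rw [← hGf]
    conv_rhs => rw [G.eq_C_content_mul_primPart]
    simp
  have hassoc : Associated (G.primPart.map (Int.castRingHom ℚ)) f :=
    (associated_unit_mul_left _ _ (isUnit_C.2 hc0.isUnit)).symm.trans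
      ((Associated.of_eq hPG).trans (associated_unit_mul_left _ _ (isUnit_C.2 hb0.isUnit)))
  refine ⟨G.primPart, ?_, ?_⟩
  · exact (IsPrimitive.Int.irreducible_iff_irreducible_map_cast G.isPrimitive_primPart).2
      (hassoc.symm.irreducible hfp.irreducible)
  · rw [hf', Ideal.span_singleton_eq_span_singleton]
    exact hassoc

/-- The irreducible polynomial `F_x ∈ ℤ[T]` of a closed point (unique up to sign). -/
def ClosedPoint.intPoly (x : ClosedPoint) : ℤ[X] := x.exists_intPoly.choose

/-- `H(x) = exp (∫₀¹ log |F_x(exp (2 π i t))| dt)`, the Mahler measure of `F_x`. -/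
def ClosedPoint.H (x : ClosedPoint) : ℝ := (x.intPoly.map (Int.castRingHom ℂ)).mahlerMeasure

theorem ClosedPoint.one_le_H (x : ClosedPoint) : 1 ≤ x.H :=
  one_le_mahlerMeasure_of_ne_zero x.exists_intPoly.choose_spec.1.ne_zero

/-- The order of vanishing of a rational function at a closed point (`0` for the zero function,
by convention). -/
def ClosedPoint.ord (x : ClosedPoint) (φ : RatFunc ℚ) : ℤ :=
  -WithZero.log (IsDedekindDomain.HeightOneSpectrum.valuation (RatFunc ℚ) x φ)

open Classical in
/-- The absolute value `|φ|_x = H(x) ^ (-ord_x φ)` of `ℚ(T)`. -/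
def ClosedPoint.absVal (x : ClosedPoint) : AbsoluteValue (RatFunc ℚ) ℝ where
  toFun φ := if φ = 0 then 0 else x.H ^ (-x.ord φ)
  map_mul' φ ψ := by
    have hH : x.H ≠ 0 := (zero_lt_one.trans_le x.one_le_H).ne'
    by_cases h1 : φ = 0
    · simp [h1]
    by_cases h2 : ψ = 0
    · simp [h2]
    simp only [mul_eq_zero, h1, h2, or_self, if_false, ClosedPoint.ord, neg_neg]
    rw [map_mul, WithZero.log_mul ((Valuation.ne_zero_iff _).2 h1)
      ((Valuation.ne_zero_iff _).2 h2), zpow_add₀ hH]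
  nonneg' φ := by
    have hH : 0 ≤ x.H := zero_le_one.trans x.one_le_H
    split_ifs
    · exact le_rfl
    · exact zpow_nonneg hH _
  eq_zero' φ := by
    have hH : x.H ≠ 0 := (zero_lt_one.trans_le x.one_le_H).ne'
    split_ifs with h
    · simp [h]
    · simp [h, zpow_ne_zero _ hH]
  add_le' φ ψ := by
    have hH : 0 ≤ x.H := zero_le_one.trans x.one_le_H
    by_cases h1 : φ = 0
    · simp [h1]
    by_cases h2 : ψ = 0
    · simp [h2]
    have n1 : 0 ≤ x.H ^ (-x.ord φ) := zpow_nonneg hH _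
    have n2 : 0 ≤ x.H ^ (-x.ord ψ) := zpow_nonneg hH _
    by_cases h3 : φ + ψ = 0
    · simp only [h1, h2, h3, if_true, if_false]
      positivity
    simp only [h1, h2, h3, if_false]
    have v3 := (Valuation.ne_zero_iff
      (IsDedekindDomain.HeightOneSpectrum.valuation (RatFunc ℚ) x)).2 h3
    rcases le_max_iff.1 (Valuation.map_add
      (IsDedekindDomain.HeightOneSpectrum.valuation (RatFunc ℚ) x) φ ψ) with h | h
    · have : -x.ord (φ + ψ) ≤ -x.ord φ := by
        simp only [ClosedPoint.ord, neg_neg]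
        exact (WithZero.log_le_log v3 ((Valuation.ne_zero_iff _).2 h1)).2 h
      have := zpow_le_zpow_right₀ x.one_le_H this
      linarith
    · have : -x.ord (φ + ψ) ≤ -x.ord ψ := by
        simp only [ClosedPoint.ord, neg_neg]
        exact (WithZero.log_le_log v3 ((Valuation.ne_zero_iff _).2 h2)).2 h
      have := zpow_le_zpow_right₀ x.one_le_H this
      linarith

/-- The value at a fraction `p / q` of the function `φ ↦ g(num φ) / g(denom φ)`. -/
theorem extendAbs_aux (g : AbsoluteValue ℚ[X] ℝ) {φ : RatFunc ℚ} {p q : ℚ[X]} (hq : q ≠ 0)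
    (h : φ = algebraMap ℚ[X] (RatFunc ℚ) p / algebraMap ℚ[X] (RatFunc ℚ) q) :
    g φ.num / g φ.denom = g p / g q := by
  rw [div_eq_div_iff (g.ne_zero φ.denom_ne_zero) (g.ne_zero hq), ← map_mul, ← map_mul]
  congr 1
  apply RatFunc.algebraMap_injective ℚ
  rw [map_mul, map_mul, ← div_eq_div_iff (RatFunc.algebraMap_ne_zero φ.denom_ne_zero)
    (RatFunc.algebraMap_ne_zero hq), RatFunc.num_div_denom, h]

/-- The extension by multiplicativity of an absolute value of `ℚ[T]` to `ℚ(T)`. -/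
def extendAbs (g : AbsoluteValue ℚ[X] ℝ) : AbsoluteValue (RatFunc ℚ) ℝ where
  toFun φ := g φ.num / g φ.denom
  map_mul' φ ψ := by
    have hφ := φ.denom_ne_zero
    have hψ := ψ.denom_ne_zero
    rw [extendAbs_aux g (p := φ.num * ψ.num) (q := φ.denom * ψ.denom) (mul_ne_zero hφ hψ)]
    · rw [map_mul, map_mul, div_mul_div_comm]
    · rw [map_mul, map_mul, ← div_mul_div_comm, RatFunc.num_div_denom, RatFunc.num_div_denom]
  nonneg' φ := div_nonneg (g.nonneg _) (g.nonneg _)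
  eq_zero' φ := by
    have hφ := g.ne_zero φ.denom_ne_zero
    simp [div_eq_zero_iff, hφ]
  add_le' φ ψ := by
    have hφ := φ.denom_ne_zero
    have hψ := ψ.denom_ne_zero
    have gφ := g.pos hφ
    have gψ := g.pos hψ
    rw [extendAbs_aux g (p := φ.num * ψ.denom + φ.denom * ψ.num) (q := φ.denom * ψ.denom)
      (mul_ne_zero hφ hψ)]
    · rw [div_add_div _ _ gφ.ne' gψ.ne', map_mul g φ.denom ψ.denom]
      gcongr
      simpa only [map_mul] using g.add_le (φ.num * ψ.denom) (φ.denom * ψ.num)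
    · have e1 := RatFunc.algebraMap_ne_zero hφ
      have e2 := RatFunc.algebraMap_ne_zero hψ
      rw [map_add, map_mul, map_mul, map_mul, ← div_add_div _ _ e1 e2,
        RatFunc.num_div_denom, RatFunc.num_div_denom]

/-- The absolute value `|φ|_p` of `ℚ[T]`: it is `max_j |a_j|_p` for `φ = ∑ a_j T ^ j`. -/
def PrimeNumber.polyAbsVal (p : PrimeNumber) : AbsoluteValue ℚ[X] ℝ :=
  haveI : Fact p.1.Prime := ⟨p.2⟩
  haveI : IsAbsoluteValue (gaussNorm (Rat.AbsoluteValue.padic p.1) 1) :=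
    gaussNorm_isAbsoluteValue
      (fun a b => by
        have h := padicNorm.nonarchimedean (p := p.1) (q := a) (r := b)
        simp only [Rat.AbsoluteValue.padic_eq_padicNorm]
        exact_mod_cast h)
      one_pos
  IsAbsoluteValue.toAbsoluteValue (gaussNorm (Rat.AbsoluteValue.padic p.1) 1)

/-- The absolute value `|φ|_p` of `ℚ(T)`. -/
def PrimeNumber.absVal (p : PrimeNumber) : AbsoluteValue (RatFunc ℚ) ℝ :=
  extendAbs p.polyAbsVal

/-- The evaluation `φ ↦ φ(exp (2 π i t))` as an embedding of `ℚ(T)` in `ℂ`. -/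
def TranscendentalAngle.evalHom (t : TranscendentalAngle) : RatFunc ℚ →+* ℂ :=
  RatFunc.liftRingHom
    (aeval (R := ℚ) (Complex.exp (2 * Real.pi * Complex.I * (t.1 : ℂ)))).toRingHom
    (nonZeroDivisors_le_comap_nonZeroDivisors_of_injective _
      (transcendental_iff_injective.1 t.2.2))

/-- The absolute value `|φ|_t = |φ(exp (2 π i t))|` of `ℚ(T)`. -/
def TranscendentalAngle.absVal (t : TranscendentalAngle) : AbsoluteValue (RatFunc ℚ) ℝ :=
  (NormedField.toAbsoluteValue ℂ).comp t.evalHom.injective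

/-! ### The adelic curve `S` on `ℚ(T)` -/

/-- The parameter space `Ω` of the adelic curve: the disjoint union of the three families. -/
abbrev Omega : Type := ClosedPoint ⊕ PrimeNumber ⊕ TranscendentalAngle

/-- The absolute value attached to a point of `Ω`. -/
def absVal : Omega → AbsoluteValue (RatFunc ℚ) ℝ
  | .inl x => x.absVal
  | .inr (.inl p) => p.absVal
  | .inr (.inr t) => t.absVal

instance : MeasurableSpace ClosedPoint := ⊤

instance : MeasurableSpace PrimeNumber := ⊤

/-- The measure `ν` on `Ω`: every closed point and every prime number has mass `1`, and the
restriction to the third family (with the trace of the Borel `σ`-algebra) is Lebesgue measure. -/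
def nu : Measure Omega :=
  Measure.map Sum.inl Measure.count +
    Measure.map (fun p : PrimeNumber => (Sum.inr (Sum.inl p) : Omega)) Measure.count +
    Measure.map (fun t : TranscendentalAngle => (Sum.inr (Sum.inr t) : Omega))
      (Measure.comap (Subtype.val : TranscendentalAngle → ℝ) volume)

/-- The height, with respect to `S`, of the point `[1 : a]` for an element `a` of a finite
extension `L` of `ℚ(T)`: the integral of `χ ↦ log max (1, |a|_χ)` over the extended adelic curve
`S ⊗ L`, whose points over `ω ∈ Ω` are the absolute values of `L` extending `|·|_ω`,
and whose measure is given by integrating the fibre averages against `ν`. -/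
def heightIn (L : Type*) [Field L] [Algebra (RatFunc ℚ) L] (a : L) : ℝ :=
  ∫ ω : Omega, fiberAverage (absVal ω) (fun w : AbsoluteValue L ℝ => Real.log (max 1 (w a))) ∂nu

/-- The height `h_S(α)` of an element of the algebraic closure of `ℚ(T)`, computed in the finite
extension `ℚ(T)(α)`. -/
def height (α : AlgebraicClosure (RatFunc ℚ)) : ℝ :=
  heightIn (RatFunc ℚ)⟮α⟯ (AdjoinSimple.gen (RatFunc ℚ) α)

end AdelicQT

end

/-! Both heights are logarithmic Mahler measures, so both statements assert a gap above zero in a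
set of Mahler measures.

Over `ℚ`, the degree times the height of a root of an irreducible nonconstant `P ∈ ℤ[X]` is
`logMahler P` (`finrank_mul_absLogHeight₁`). Over `ℚ(T)`, let `P ∈ ℤ[T][Y]` be irreducible of
positive degree in `Y`. At a non-archimedean place Gauss's lemma gives `-log |lc P|` for the degree
times the local height of a root; at an angle `t` Jensen's formula gives `log M(P(e^{2πit}, ·)) -
log |lc P|`. The product formula (`integral_log_absVal`) removes the leading coefficient, and what
is left is the two-variable Mahler measure `logMahler₂ P` (`finrank_mul_height`).

A polynomial with constant coefficients has the same Mahler measure in two variables as in one,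
which yields the implication from `ℚ(T)` to `ℚ`.

For the converse, suppose that no one-variable value lies strictly between `0` and `c`, and that
`logMahler₂ P < c`. Restriction to the curve `x = z^n` raises the Mahler measure by at most `O(1/n)`
(`logMahler_le_of_eval_eq`), so `P(z^n, z)` has logarithmic Mahler measure zero for all large `n`,
and its roots lie in the closed unit disc. Hurwitz's theorem carries this to the limit: the roots of
the leading coefficient, and those of the nonzero specialisations at points of the unit circle, lie
in the closed disc. Jensen's formula, used twice, then gives `logMahler₂ P = 0`
(`logMahler₂_eq_zero_of_eventually`). No limit formula for Mahler measures is needed, only the upper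
bound and this rigidity. -/

noncomputable section

namespace AdelicQT

/-! ### Hurwitz's theorem and Mahler measures in one and two variables -/

section Analysis

open Filter Topology

/-- A form of Hurwitz's theorem: if holomorphic functions converge continuously to a function with
an isolated zero, then almost all of them have a zero nearby. -/
theorem eventually_exists_zero_of_tendsto {U : Set ℂ} (hU : IsOpen U) {f : ℂ → ℂ}
    {F : ℕ → ℂ → ℂ} (hF : ∀ᶠ n in atTop, DifferentiableOn ℂ (F n) U)
    (hlim : ∀ z ∈ U, Tendsto (fun p : ℕ × ℂ => F p.1 p.2) (atTop ×ˢ 𝓝 z) (𝓝 (f z)))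
    {c : ℂ} (hc : c ∈ U) (hf : AnalyticOnNhd ℂ f U) (hfc : f c = 0)
    (hne : ¬ ∀ᶠ z in 𝓝 c, f z = 0) : ∀ᶠ n in atTop, ∃ z ∈ U, F n z = 0 := by
  have h1 : ∀ᶠ z in 𝓝[≠] c, f z ≠ 0 :=
    (hf c hc).eventually_eq_zero_or_eventually_ne_zero.resolve_left hne
  rw [eventually_nhdsWithin_iff] at h1
  obtain ⟨r, hr, hrU⟩ := Metric.nhds_basis_closedBall.mem_iff.1 (h1.and (hU.mem_nhds hc))
  have hsU : Metric.closedBall c r ⊆ U := fun z hz => (hrU hz).2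
  have hsph : ∀ z ∈ Metric.sphere c r, f z ≠ 0 := fun z hz =>
    (hrU (Metric.sphere_subset_closedBall hz)).1 (by
      rintro rfl
      simp [hr.ne] at hz)
  obtain ⟨z₀, hz₀, hmin⟩ := (isCompact_sphere c r).exists_isMinOn
    (NormedSpace.sphere_nonempty.2 hr.le)
    ((hf.continuousOn.mono (Metric.sphere_subset_closedBall.trans hsU)).norm)
  set δ := ‖f z₀‖ with hδ
  have hδ0 : 0 < δ := norm_pos_iff.2 (hsph z₀ hz₀)
  -- Continuous convergence gives the bound near each point of the circle; compactness makes it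
  -- uniform in `z`.
  have hbig : ∀ᶠ n in atTop, ∀ z ∈ Metric.sphere c r, δ / 2 < ‖F n z‖ := by
    have key : ∀ z ∈ Metric.sphere c r, ∀ᶠ p in (𝓝 z ×ˢ atTop : Filter (ℂ × ℕ)),
        δ / 2 < ‖F p.2 p.1‖ := by
      intro z hz
      have h2 : δ / 2 < ‖f z‖ := (half_lt_self hδ0).trans_le (hmin hz)
      have := (hlim z (hsU (Metric.sphere_subset_closedBall hz))).norm.eventually_const_lt h2
      exact eventually_swap_iff.1 this
    have h3 := (isCompact_sphere c r).mem_nhdsSet_prod_of_forall (l := (atTop : Filter ℕ))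
      (s := {p : ℂ × ℕ | δ / 2 < ‖F p.2 p.1‖}) key
    rw [mem_prod_iff] at h3
    obtain ⟨t, ht, u, hu, htu⟩ := h3
    filter_upwards [hu] with n hn z hz
    exact htu (Set.mk_mem_prod (subset_of_mem_nhdsSet ht hz) hn)
  have hsmall : ∀ᶠ n in atTop, ‖F n c‖ < δ / 2 := by
    have h2 : Tendsto (fun n : ℕ => (n, c)) atTop (atTop ×ˢ 𝓝 c) :=
      tendsto_id.prodMk tendsto_const_nhds
    have h3 := ((hlim c hc).comp h2).norm
    rw [hfc, norm_zero] at h3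
    exact h3.eventually_lt_const (half_pos hδ0)
  filter_upwards [hF, hbig, hsmall] with n h1 h2 h3
  by_contra! hcon
  -- Maximum principle for `1 / F n`: its modulus is at most `2 / δ` on the circle but exceeds `2 /
  -- δ` at the centre.
  have hd : DiffContOnCl ℂ (fun z => (F n z)⁻¹) (Metric.ball c r) := by
    apply DifferentiableOn.diffContOnCl
    rw [closure_ball c hr.ne']
    exact (h1.mono hsU).inv fun z hz => hcon z (hsU hz)
  have h4 := Complex.norm_le_of_forall_mem_frontier_norm_le Metric.isBounded_ball hd
    (C := (δ / 2)⁻¹) (by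
      intro z hz
      rw [frontier_ball c hr.ne'] at hz
      rw [norm_inv]
      exact inv_anti₀ (half_pos hδ0) (h2 z hz).le)
    (subset_closure (Metric.mem_ball_self hr))
  rw [norm_inv] at h4
  have h5 := (inv_le_inv₀ (norm_pos_iff.2 (hcon c hc)) (half_pos hδ0)).1 h4
  linarith

/-- The specialisation `P(x, ·)` of an integral polynomial in two variables. -/
def specialize (P : ℤ[X][X]) (x : ℂ) : ℂ[X] := P.map (aeval x : ℤ[X] →ₐ[ℤ] ℂ).toRingHom

/-- The logarithmic Mahler measure of an integral polynomial in two variables. -/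
def logMahler₂ (P : ℤ[X][X]) : ℝ :=
  Real.circleAverage (fun x => (specialize P x).logMahlerMeasure) 0 1

/-- The logarithmic Mahler measure of an integral polynomial. -/
def logMahler (Q : ℤ[X]) : ℝ := (Q.map (Int.castRingHom ℂ)).logMahlerMeasure

theorem specialize_coeff (P : ℤ[X][X]) (x : ℂ) (i : ℕ) :
    (specialize P x).coeff i = aeval x (P.coeff i) := by
  simp [specialize]

theorem eval_specialize (P : ℤ[X][X]) (x y : ℂ) :
    (specialize P x).eval y = aevalAeval x y P := by
  induction P using Polynomial.induction_on' with
  | add p q hp hq =>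
    rw [specialize] at hp hq ⊢
    rw [Polynomial.map_add, eval_add, hp, hq, map_add]
  | monomial n a =>
    rw [specialize, map_monomial, eval_monomial, ← C_mul_X_pow_eq_monomial, map_mul, map_pow,
      aevalAeval_C, aevalAeval_Y]
    rfl

theorem eval_specialize_swap (P : ℤ[X][X]) (x y : ℂ) :
    (specialize (Bivariate.swap P) y).eval x = (specialize P x).eval y := by
  rw [eval_specialize, eval_specialize, Bivariate.aevalAeval_swap]

theorem natDegree_specialize_le (P : ℤ[X][X]) (x : ℂ) :
    (specialize P x).natDegree ≤ P.natDegree := natDegree_map_le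

theorem map_ne_zero_of_ne_zero {Q : ℤ[X]} (hQ : Q ≠ 0) : Q.map (Int.castRingHom ℂ) ≠ 0 :=
  (Polynomial.map_ne_zero_iff (Int.castRingHom ℂ).injective_int).2 hQ

theorem finite_zeros {Q : ℤ[X]} (hQ : Q ≠ 0) : {x : ℂ | aeval x Q = 0}.Finite := by
  refine (Q.map (Int.castRingHom ℂ)).roots.toFinset.finite_toSet.subset fun x hx => ?_
  simp only [Multiset.mem_toFinset, Finset.mem_coe]
  rw [mem_roots (map_ne_zero_of_ne_zero hQ), IsRoot.def, eval_map]
  exact hx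

theorem ae_circleMap_notMem {S : Set ℂ} (hS : S.Countable) :
    ∀ᵐ θ : ℝ, circleMap 0 1 θ ∉ S := by
  have := (hS.preimage_circleMap 0 one_ne_zero).measure_zero volume
  exact measure_eq_zero_iff_ae_notMem.1 this

theorem ae_aeval_circleMap_ne_zero {Q : ℤ[X]} (hQ : Q ≠ 0) :
    ∀ᵐ θ : ℝ, aeval (circleMap 0 1 θ) Q ≠ 0 :=
  ae_circleMap_notMem (finite_zeros hQ).countable

theorem continuous_eval_specialize (P : ℤ[X][X]) :
    Continuous fun p : ℂ × ℂ => (specialize P p.1).eval p.2 := by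
  have : (fun p : ℂ × ℂ => (specialize P p.1).eval p.2) =
      fun p => ∑ i ∈ Finset.range (P.natDegree + 1), aeval p.1 (P.coeff i) * p.2 ^ i := by
    ext p
    rw [eval_eq_sum_range' (Nat.lt_succ_of_le (natDegree_specialize_le P p.1))]
    simp [specialize_coeff]
  rw [this]
  fun_prop

theorem logMahler_nonneg {Q : ℤ[X]} (hQ : Q ≠ 0) : 0 ≤ logMahler Q := by
  rw [logMahler, logMahlerMeasure_eq_log_MahlerMeasure]
  exact Real.log_nonneg (one_le_mahlerMeasure_of_ne_zero hQ)

theorem logMahler_mul {Q R : ℤ[X]} (hQ : Q ≠ 0) (hR : R ≠ 0) :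
    logMahler (Q * R) = logMahler Q + logMahler R := by
  rw [logMahler, Polynomial.map_mul, logMahlerMeasure_mul_eq_add_logMahlerMeasure
    (mul_ne_zero (map_ne_zero_of_ne_zero hQ) (map_ne_zero_of_ne_zero hR))]
  rfl

theorem mahlerMeasure_eq_one_of_logMahler_eq_zero {Q : ℤ[X]} (hQ : Q ≠ 0) (h : logMahler Q = 0) :
    (Q.map (Int.castRingHom ℂ)).mahlerMeasure = 1 := by
  rw [mahlerMeasure, if_pos (map_ne_zero_of_ne_zero hQ)]
  rw [logMahler] at h
  rw [h, Real.exp_zero]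

/-- The roots of an integral polynomial of Mahler measure one lie in the closed unit disc. -/
theorem norm_le_one_of_logMahler_eq_zero {Q : ℤ[X]} (hQ : Q ≠ 0) (h : logMahler Q = 0) {z : ℂ}
    (hz : aeval z Q = 0) : ‖z‖ ≤ 1 := by
  refine norm_root_le_one_of_mahlerMeasure_eq_one
    (mahlerMeasure_eq_one_of_logMahler_eq_zero hQ h) ?_
  rw [mem_aroots]
  exact ⟨hQ, hz⟩

/-! ### Two-variable Mahler measures as iterated integrals -/

/-- The function `log |P|` on the torus. -/
def torusLog (P : ℤ[X][X]) (θ s : ℝ) : ℝ :=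
  Real.log ‖(specialize P (circleMap 0 1 θ)).eval (circleMap 0 1 s)‖

/-- Lebesgue measure on `(0, 2π]`. -/
abbrev circleMeasure : Measure ℝ := volume.restrict (Set.Ioc 0 (2 * Real.pi))

theorem logMahlerMeasure_specialize_eq (P : ℤ[X][X]) (θ : ℝ) :
    (specialize P (circleMap 0 1 θ)).logMahlerMeasure =
      (2 * Real.pi)⁻¹ * ∫ s, torusLog P θ s ∂circleMeasure := by
  rw [logMahlerMeasure_def, Real.circleAverage_def,
    intervalIntegral.integral_of_le Real.two_pi_pos.le]
  rfl

theorem measurable_torusLog (P : ℤ[X][X]) :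
    Measurable (Function.uncurry (torusLog P)) := by
  refine Real.measurable_log.comp (Continuous.measurable ?_)
  refine Continuous.norm ?_
  exact (continuous_eval_specialize P).comp
    (((continuous_circleMap 0 1).comp continuous_fst).prodMk
      ((continuous_circleMap 0 1).comp continuous_snd))

theorem integrable_torusLog_right (P : ℤ[X][X]) (θ : ℝ) :
    Integrable (torusLog P θ) circleMeasure :=
  (intervalIntegrable_iff_integrableOn_Ioc_of_le Real.two_pi_pos.le).1
    (intervalIntegrable_mahlerMeasure (specialize P (circleMap 0 1 θ)))

theorem exists_torusLog_le (P : ℤ[X][X]) : ∃ B : ℝ, 0 ≤ B ∧ ∀ θ s, torusLog P θ s ≤ B := by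
  have hc : IsCompact ((Metric.sphere (0 : ℂ) 1) ×ˢ (Metric.sphere (0 : ℂ) 1)) :=
    (isCompact_sphere 0 1).prod (isCompact_sphere 0 1)
  obtain ⟨M, hM⟩ := hc.exists_bound_of_continuousOn (continuous_eval_specialize P).continuousOn
  -- At a zero of `P` on the torus `Real.log 0 = 0`, so the bound has to be nonnegative; hence `max
  -- M 1`.
  refine ⟨Real.log (max M 1), Real.log_nonneg (le_max_right _ _), fun θ s => ?_⟩
  rcases (norm_nonneg ((specialize P (circleMap 0 1 θ)).eval (circleMap 0 1 s))).eq_or_lt with h | h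
  · rw [torusLog, ← h, Real.log_zero]
    exact Real.log_nonneg (le_max_right _ _)
  · exact Real.log_le_log h ((hM (circleMap 0 1 θ, circleMap 0 1 s)
      ⟨circleMap_mem_sphere 0 zero_le_one θ, circleMap_mem_sphere 0 zero_le_one s⟩).trans
      (le_max_left _ _))

/-- By Jensen's formula the difference is a sum of `log⁺` over the roots. This is the lower bound
behind the integrability statements below. -/
theorem log_leadingCoeff_le_logMahlerMeasure (p : ℂ[X]) :
    Real.log ‖p.leadingCoeff‖ ≤ p.logMahlerMeasure := by
  rw [logMahlerMeasure_eq_log_leadingCoeff_add_sum_log_roots]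
  refine le_add_of_nonneg_right (Multiset.sum_nonneg fun x hx => ?_)
  obtain ⟨a, -, rfl⟩ := Multiset.mem_map.1 hx
  exact Real.posLog_nonneg

theorem leadingCoeff_specialize {P : ℤ[X][X]} {x : ℂ} (h : aeval x P.leadingCoeff ≠ 0) :
    (specialize P x).leadingCoeff = aeval x P.leadingCoeff :=
  leadingCoeff_map_of_leadingCoeff_ne_zero _ h

/-- The Mahler measure of a specialisation is integrable over the circle. -/
theorem integrable_logMahlerMeasure_specialize {P : ℤ[X][X]} (hP : P ≠ 0) :
    Integrable (fun θ => (specialize P (circleMap 0 1 θ)).logMahlerMeasure) circleMeasure := by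
  obtain ⟨B, hB0, hB⟩ := exists_torusLog_le P
  -- The Mahler measure of the specialisation is squeezed, almost everywhere, between this
  -- integrable function and the constant `B`.
  have hlc : Integrable (fun θ => Real.log ‖aeval (circleMap 0 1 θ) P.leadingCoeff‖)
      circleMeasure := by
    have := (intervalIntegrable_iff_integrableOn_Ioc_of_le Real.two_pi_pos.le).1
      (intervalIntegrable_mahlerMeasure (P.leadingCoeff.map (Int.castRingHom ℂ)))
    refine this.congr (ae_of_all _ fun θ => ?_)
    simp only [eval_map]
    rfl
  refine Integrable.mono' ((integrable_const B).add hlc.norm) ?_ ?_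
  · simp only [logMahlerMeasure_specialize_eq]
    exact (((measurable_torusLog P).stronglyMeasurable.integral_prod_right).const_mul
      _).aestronglyMeasurable
  · filter_upwards [ae_restrict_of_ae
      (ae_aeval_circleMap_ne_zero (leadingCoeff_ne_zero.2 hP))] with θ hθ
    have h1 := log_leadingCoeff_le_logMahlerMeasure (specialize P (circleMap 0 1 θ))
    rw [leadingCoeff_specialize hθ] at h1
    have h2 : (specialize P (circleMap 0 1 θ)).logMahlerMeasure ≤ B := by
      rw [logMahlerMeasure_specialize_eq]
      calc _ ≤ (2 * Real.pi)⁻¹ * ∫ s, B ∂circleMeasure := by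
            refine mul_le_mul_of_nonneg_left ?_ (by positivity)
            exact integral_mono (integrable_torusLog_right P θ) (integrable_const B) (hB θ)
        _ = B := by
            simp [Real.pi_pos.le]
            field_simp
    simp only [Pi.add_apply, Real.norm_eq_abs]
    rw [abs_le]
    constructor
    · have := neg_abs_le (Real.log ‖aeval (circleMap 0 1 θ) P.leadingCoeff‖)
      linarith
    · have := abs_nonneg (Real.log ‖aeval (circleMap 0 1 θ) P.leadingCoeff‖)
      linarith

/-- Since `log |P| ≤ B` with `B ≥ 0`, the absolute value is at most `2B - log |P|`, whose iterated
integral is finite. This is what Fubini's theorem needs. -/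
theorem integrable_torusLog {P : ℤ[X][X]} (hP : P ≠ 0) :
    Integrable (Function.uncurry (torusLog P)) (circleMeasure.prod circleMeasure) := by
  obtain ⟨B, hB0, hB⟩ := exists_torusLog_le P
  rw [integrable_prod_iff (measurable_torusLog P).aestronglyMeasurable]
  refine ⟨ae_of_all _ fun θ => integrable_torusLog_right P θ, ?_⟩
  have hL : Integrable (fun θ => ∫ s, torusLog P θ s ∂circleMeasure) circleMeasure := by
    refine ((integrable_logMahlerMeasure_specialize hP).const_mul (2 * Real.pi)).congr
      (ae_of_all _ fun θ => ?_)
    simp only [logMahlerMeasure_specialize_eq]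
    field_simp
  refine Integrable.mono' ((integrable_const (∫ _, 2 * B ∂circleMeasure)).sub hL) ?_
    (ae_of_all _ fun θ => ?_)
  · exact ((measurable_torusLog P).norm.stronglyMeasurable.integral_prod_right
      (f := fun a b => ‖torusLog P a b‖)).aestronglyMeasurable
  · rw [Real.norm_of_nonneg (integral_nonneg fun _ => norm_nonneg _)]
    simp only [Pi.sub_apply]
    rw [← integral_sub (integrable_const _) (integrable_torusLog_right P θ)]
    refine integral_mono (integrable_torusLog_right P θ).norm
      ((integrable_const _).sub (integrable_torusLog_right P θ)) fun s => ?_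
    simp only [Function.uncurry_apply_pair, Real.norm_eq_abs]
    have := hB θ s
    rw [abs_le]
    constructor <;> linarith

theorem logMahler₂_eq (P : ℤ[X][X]) : logMahler₂ P =
    (2 * Real.pi)⁻¹ * ((2 * Real.pi)⁻¹ *
      ∫ θ, ∫ s, torusLog P θ s ∂circleMeasure ∂circleMeasure) := by
  rw [logMahler₂, Real.circleAverage_def, intervalIntegral.integral_of_le Real.two_pi_pos.le]
  simp only [logMahlerMeasure_specialize_eq, smul_eq_mul, integral_const_mul]

/-- Fubini on the torus. The symmetry is needed because the upper bound concerns `P(z^n, z)` and the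
rigidity argument `P(z, z^n)`. -/
theorem logMahler₂_swap {P : ℤ[X][X]} (hP : P ≠ 0) :
    logMahler₂ (Bivariate.swap P) = logMahler₂ P := by
  rw [logMahler₂_eq, logMahler₂_eq, integral_integral_swap (integrable_torusLog hP)]
  simp only [torusLog, eval_specialize_swap]

/-! ### Specialisation along `x = z ^ n` -/

/-- The `ζ k` are the `n`-th roots of `x`. Both sides are multiplicative in `p`, and for `X - a` the
product is `|a^n - x| ≤ 2 max(1, |a|)^n`; each root costs one factor `2`, independently of `n`. -/
theorem prod_norm_eval_le {n : ℕ} {ζ : ℕ → ℂ} {x : ℂ} (hx : ‖x‖ = 1)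
    (hζ : ∀ α : ℂ, ∏ k ∈ Finset.range n, (α - ζ k) = α ^ n - x) (p : ℂ[X]) :
    ∏ k ∈ Finset.range n, ‖p.eval (ζ k)‖ ≤ 2 ^ p.natDegree * p.mahlerMeasure ^ n := by
  have hlin : ∀ s : Multiset ℂ, ∏ k ∈ Finset.range n, ‖(s.map fun a => X - C a).prod.eval (ζ k)‖ ≤
      2 ^ Multiset.card s * (s.map fun a => X - C a).prod.mahlerMeasure ^ n := by
    intro s
    induction s using Multiset.induction_on with
    | empty => simp
    | cons a s ih =>
      simp only [Multiset.map_cons, Multiset.prod_cons, eval_mul, norm_mul,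
        Finset.prod_mul_distrib, mahlerMeasure_mul, Multiset.card_cons, mahlerMeasure_X_sub_C,
        eval_sub, eval_X, eval_C]
      have h1 : ∏ k ∈ Finset.range n, ‖ζ k - a‖ ≤ 2 * max 1 ‖a‖ ^ n := by
        simp only [norm_sub_rev _ a]
        rw [← norm_prod, hζ]
        refine (norm_sub_le _ _).trans ?_
        rw [norm_pow, hx]
        have h2 : ‖a‖ ^ n ≤ max 1 ‖a‖ ^ n := by gcongr; exact le_max_right _ _
        have h3 : 1 ≤ max 1 ‖a‖ ^ n := one_le_pow₀ (le_max_left _ _)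
        linarith
      calc _ ≤ (2 * max 1 ‖a‖ ^ n) *
            (2 ^ Multiset.card s * (s.map fun a => X - C a).prod.mahlerMeasure ^ n) :=
            mul_le_mul h1 ih (by positivity) (by positivity)
        _ = _ := by ring
  have h1 := (IsAlgClosed.splits p).eq_prod_roots
  have h2 := hlin p.roots
  rw [← (IsAlgClosed.splits p).natDegree_eq_card_roots] at h2
  have h3 : p.mahlerMeasure = ‖p.leadingCoeff‖ *
      (p.roots.map fun a => X - C a).prod.mahlerMeasure := by
    conv_lhs => rw [h1]
    rw [mahlerMeasure_mul, mahlerMeasure_const]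
  calc ∏ k ∈ Finset.range n, ‖p.eval (ζ k)‖
      = ‖p.leadingCoeff‖ ^ n *
        ∏ k ∈ Finset.range n, ‖(p.roots.map fun a => X - C a).prod.eval (ζ k)‖ := by
        conv_lhs => rw [h1]
        simp [Finset.prod_mul_distrib]
    _ ≤ ‖p.leadingCoeff‖ ^ n * (2 ^ p.natDegree *
        (p.roots.map fun a => X - C a).prod.mahlerMeasure ^ n) := by gcongr
    _ = _ := by rw [h3]; ring

theorem prod_sub_circleMap {n : ℕ} (hn : n ≠ 0) (φ : ℝ) (α : ℂ) :
    ∏ k ∈ Finset.range n, (α - circleMap 0 1 (φ / n + k * (2 * Real.pi / n))) =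
      α ^ n - circleMap 0 1 φ := by
  have hω := Complex.isPrimitiveRoot_exp n hn
  set ω := Complex.exp (2 * Real.pi * Complex.I / n) with hωdef
  have hn' : (n : ℂ) ≠ 0 := Nat.cast_ne_zero.2 hn
  have hset : nthRootsFinset n (1 : ℂ) = (Finset.range n).image fun k => ω ^ k := by
    symm
    apply Finset.eq_of_subset_of_card_le
    · intro z hz
      obtain ⟨k, -, rfl⟩ := Finset.mem_image.1 hz
      rw [mem_nthRootsFinset (Nat.pos_of_ne_zero hn), ← pow_mul, mul_comm, pow_mul, hω.pow_eq_one,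
        one_pow]
    · rw [hω.card_nthRootsFinset, Finset.card_image_of_injOn, Finset.card_range]
      intro i hi j hj hij
      exact hω.pow_inj (Finset.mem_range.1 hi) (Finset.mem_range.1 hj) hij
  have hy : (circleMap 0 1 (φ / n)) ^ n = circleMap 0 1 φ := by
    simp only [circleMap, Complex.ofReal_one, one_mul, zero_add]
    rw [← Complex.exp_nat_mul]
    congr 1
    push_cast
    field_simp
  rw [← hy, hω.pow_sub_pow_eq_prod_sub_mul _ _ (Nat.pos_of_ne_zero hn), hset, Finset.prod_image]
  · refine Finset.prod_congr rfl fun k _ => ?_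
    congr 1
    simp only [circleMap, Complex.ofReal_one, one_mul, zero_add]
    rw [hωdef, ← Complex.exp_nat_mul, ← Complex.exp_add]
    congr 1
    push_cast
    ring
  · intro i hi j hj hij
    exact hω.pow_inj (Finset.mem_range.1 hi) (Finset.mem_range.1 hj) hij

/-- Specialising along `x = z ^ n` increases the Mahler measure by at most `O(1 / n)`. -/
theorem logMahler_le_of_eval_eq {P : ℤ[X][X]} (hP : P ≠ 0) {Q : ℤ[X]} (hQ : Q ≠ 0) {n : ℕ}
    (hn : n ≠ 0) (hPQ : ∀ z : ℂ, aeval z Q = (specialize P (z ^ n)).eval z) :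
    logMahler Q ≤ logMahler₂ P + P.natDegree * Real.log 2 / n := by
  have hn0 : (0 : ℝ) < n := Nat.cast_pos.2 (Nat.pos_of_ne_zero hn)
  set F : ℝ → ℝ := fun θ => Real.log ‖aeval (circleMap 0 1 θ) Q‖ with hF
  have hFper : Function.Periodic F (2 * Real.pi) := fun θ => by
    simp only [hF, periodic_circleMap 0 1 θ]
  have hFint : ∀ a b, IntervalIntegrable F volume a b := by
    refine hFper.intervalIntegrable₀ Real.two_pi_pos.ne' ?_
    have := intervalIntegrable_mahlerMeasure (Q.map (Int.castRingHom ℂ))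
    simp only [eval_map] at this
    exact this
  -- Cut the circle into `n` equal arcs and rescale each to full length: the points above a given
  -- `φ` are then the `n`-th roots of `e^{iφ}`.
  have h1 : ∫ θ in (0 : ℝ)..2 * Real.pi, F θ = ∑ k ∈ Finset.range n,
      (n : ℝ)⁻¹ * ∫ φ in (0 : ℝ)..2 * Real.pi, F (φ / n + k * (2 * Real.pi / n)) := by
    have h2 := intervalIntegral.sum_integral_adjacent_intervals (f := F) (μ := volume)
      (a := fun k : ℕ => k * (2 * Real.pi / n)) (n := n) fun k _ => hFint _ _
    have h3 : ((n : ℕ) : ℝ) * (2 * Real.pi / n) = 2 * Real.pi := by field_simp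
    simp only [h3, Nat.cast_zero, zero_mul] at h2
    rw [← h2]
    refine Finset.sum_congr rfl fun k _ => ?_
    rw [intervalIntegral.integral_comp_div_add F hn0.ne', smul_eq_mul, ← mul_assoc,
      inv_mul_cancel₀ hn0.ne', one_mul]
    congr 1
    · simp
    · push_cast
      ring
  have hint : ∀ k : ℕ, IntervalIntegrable (fun φ => F (φ / n + k * (2 * Real.pi / n))) volume
      0 (2 * Real.pi) := by
    intro k
    have h2 : IntervalIntegrable (fun φ => F (φ + k * (2 * Real.pi / n))) volume
        0 (2 * Real.pi * (n : ℝ)⁻¹) := by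
      have := (hFint (0 + k * (2 * Real.pi / n))
        (2 * Real.pi * (n : ℝ)⁻¹ + k * (2 * Real.pi / n))).comp_add_right (k * (2 * Real.pi / n))
      simpa using this
    have := h2.comp_mul_right (c := (n : ℝ)⁻¹)
    simpa [div_eq_mul_inv, hn0.ne'] using this
  rw [← Finset.mul_sum, ← intervalIntegral.integral_finsetSum fun k _ => hint k] at h1
  have hLint : IntervalIntegrable (fun φ => (specialize P (circleMap 0 1 φ)).logMahlerMeasure)
      volume 0 (2 * Real.pi) :=
    (intervalIntegrable_iff_integrableOn_Ioc_of_le Real.two_pi_pos.le).2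
      (integrable_logMahlerMeasure_specialize hP)
  have hsum : IntervalIntegrable (fun φ => ∑ k ∈ Finset.range n,
      F (φ / n + k * (2 * Real.pi / n))) volume 0 (2 * Real.pi) := by
    simpa only [Finset.sum_fn] using IntervalIntegrable.sum (Finset.range n) fun k _ => hint k
  have hle : ∫ φ in (0 : ℝ)..2 * Real.pi,
        ∑ k ∈ Finset.range n, F (φ / n + k * (2 * Real.pi / n)) ≤
      ∫ φ in (0 : ℝ)..2 * Real.pi, (n * (specialize P (circleMap 0 1 φ)).logMahlerMeasure +
        P.natDegree * Real.log 2) := by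
    refine intervalIntegral.integral_mono_ae Real.two_pi_pos.le
      hsum
      ((hLint.const_mul _).add intervalIntegrable_const) ?_
    -- Discarding the `n`-th powers of the zeros of `Q` ensures that no logarithm is evaluated at
    -- `0` and that the specialisation at `e^{iφ}` is nonzero.
    have hae : ∀ᵐ φ : ℝ, circleMap 0 1 φ ∉ (fun z : ℂ => z ^ n) '' {z | aeval z Q = 0} :=
      ae_circleMap_notMem ((finite_zeros hQ).countable.image _)
    filter_upwards [hae] with φ hφ
    have hpow : ∀ k : ℕ, (circleMap 0 1 (φ / n + k * (2 * Real.pi / n))) ^ n =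
        circleMap 0 1 φ := by
      intro k
      simp only [circleMap, Complex.ofReal_one, one_mul, zero_add]
      rw [← Complex.exp_nat_mul, Complex.exp_eq_exp_iff_exists_int]
      refine ⟨k, ?_⟩
      have : (n : ℂ) ≠ 0 := Nat.cast_ne_zero.2 hn
      push_cast
      field_simp
    have hne : ∀ k : ℕ, aeval (circleMap 0 1 (φ / n + k * (2 * Real.pi / n))) Q ≠ 0 :=
      fun k hk => hφ ⟨_, hk, hpow k⟩
    have heq : ∀ k : ℕ, aeval (circleMap 0 1 (φ / n + k * (2 * Real.pi / n))) Q =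
        (specialize P (circleMap 0 1 φ)).eval (circleMap 0 1 (φ / n + k * (2 * Real.pi / n))) :=
      fun k => by rw [hPQ, hpow]
    simp only [hF, heq]
    set p := specialize P (circleMap 0 1 φ) with hp
    have hp0 : p ≠ 0 := by
      intro h
      refine hne 0 ?_
      rw [heq, h, eval_zero]
    have hM := mahlerMeasure_pos_of_ne_zero hp0
    have hprod := prod_norm_eval_le (n := n) (x := circleMap 0 1 φ) (by simp)
      (prod_sub_circleMap hn φ) p
    rw [← Real.log_prod fun k _ => norm_ne_zero_iff.2 (heq k ▸ hne k)]
    calc _ ≤ Real.log (2 ^ p.natDegree * p.mahlerMeasure ^ n) :=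
          Real.log_le_log (Finset.prod_pos fun k _ => norm_pos_iff.2 (heq k ▸ hne k)) hprod
      _ = n * p.logMahlerMeasure + p.natDegree * Real.log 2 := by
          rw [Real.log_mul (by positivity) (by positivity), Real.log_pow, Real.log_pow,
            logMahlerMeasure_eq_log_MahlerMeasure, add_comm]
      _ ≤ _ := by
          gcongr
          exact natDegree_specialize_le P _
  rw [intervalIntegral.integral_add (hLint.const_mul _) intervalIntegrable_const,
    intervalIntegral.integral_const_mul, intervalIntegral.integral_const] at hle
  have hlhs : logMahler Q = (2 * Real.pi)⁻¹ * ∫ θ in (0 : ℝ)..2 * Real.pi, F θ := by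
    rw [logMahler, logMahlerMeasure_def, Real.circleAverage_def]
    simp only [eval_map]
    rfl
  have hpi := Real.pi_pos
  rw [hlhs, h1, logMahler₂, Real.circleAverage_def, smul_eq_mul]
  refine (mul_le_mul_of_nonneg_left (mul_le_mul_of_nonneg_left hle (by positivity))
    (by positivity)).trans_eq ?_
  rw [smul_eq_mul]
  field_simp
  ring

/-! ### Polynomials all of whose specialisations have Mahler measure one -/

theorem aeval_eval_X_pow (P : ℤ[X][X]) (n : ℕ) (z : ℂ) :
    aeval z (P.eval (X ^ n)) = (specialize P z).eval (z ^ n) := by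
  rw [specialize, eval_map, eval₂_eq_sum_range, eval_eq_sum_range, map_sum]
  refine Finset.sum_congr rfl fun i _ => ?_
  simp

/-- Once `n` exceeds the degrees of all coefficients, the blocks `P_i(z) z^{ni}` occupy disjoint
ranges of exponents, so the top term comes from the leading coefficient alone. -/
theorem natDegree_eval_X_pow {P : ℤ[X][X]} (hP : P ≠ 0) {n : ℕ}
    (hn : ∀ i, (P.coeff i).natDegree < n) :
    (P.eval (X ^ n : ℤ[X])).natDegree = n * P.natDegree + P.leadingCoeff.natDegree ∧
      (P.eval (X ^ n : ℤ[X])).leadingCoeff = P.leadingCoeff.leadingCoeff := by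
  have hcoeff : (P.eval (X ^ n : ℤ[X])).coeff (n * P.natDegree + P.leadingCoeff.natDegree) =
      P.leadingCoeff.leadingCoeff := by
    rw [eval_eq_sum_range, finsetSum_coeff, Finset.sum_range_succ, Finset.sum_eq_zero, zero_add]
    · rw [← pow_mul, add_comm, coeff_mul_X_pow]
      rfl
    · intro i hi
      rw [Finset.mem_range] at hi
      have h1 : n * i + n ≤ n * P.natDegree := by
        rw [← Nat.mul_succ]
        exact Nat.mul_le_mul_left n hi
      rw [← pow_mul, coeff_mul_X_pow']
      split_ifs
      · apply coeff_eq_zero_of_natDegree_lt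
        have := hn i
        omega
      · rfl
  have hle : (P.eval (X ^ n : ℤ[X])).natDegree ≤
      n * P.natDegree + P.leadingCoeff.natDegree := by
    rw [eval_eq_sum_range]
    refine natDegree_sum_le_of_forall_le _ _ fun i hi => ?_
    rw [← pow_mul]
    refine (natDegree_mul_le).trans ?_
    rw [natDegree_X_pow]
    rcases (Nat.lt_succ_iff.1 (Finset.mem_range.1 hi)).eq_or_lt with rfl | h
    · rw [add_comm]
      rfl
    · have h1 : n * i + n ≤ n * P.natDegree := by
        rw [← Nat.mul_succ]
        exact Nat.mul_le_mul_left n h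
      have := hn i
      omega
  have h0 : P.leadingCoeff.leadingCoeff ≠ 0 :=
    leadingCoeff_ne_zero.2 (leadingCoeff_ne_zero.2 hP)
  have heq := le_antisymm hle (le_natDegree_of_ne_zero (by rwa [hcoeff]))
  exact ⟨heq, by rw [leadingCoeff, heq, hcoeff]⟩

theorem eventually_natDegree_coeff_lt (P : ℤ[X][X]) :
    ∀ᶠ n : ℕ in atTop, ∀ i, (P.coeff i).natDegree < n := by
  filter_upwards [eventually_gt_atTop (P.support.sup fun i => (P.coeff i).natDegree)] with n hn i
  by_cases hi : i ∈ P.support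
  · exact (Finset.le_sup (f := fun i => (P.coeff i).natDegree) hi).trans_lt hn
  · rw [notMem_support_iff.1 hi]
    simp only [natDegree_zero]
    omega

theorem eventually_eval_X_pow_ne_zero {P : ℤ[X][X]} (hP : P ≠ 0) :
    ∀ᶠ n : ℕ in atTop, P.eval (X ^ n : ℤ[X]) ≠ 0 := by
  filter_upwards [eventually_natDegree_coeff_lt P] with n hn h
  have := (natDegree_eval_X_pow hP hn).2
  rw [h, leadingCoeff_zero] at this
  exact leadingCoeff_ne_zero.2 (leadingCoeff_ne_zero.2 hP) this.symm

variable {P : ℤ[X][X]}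

/-- If `P(z, z ^ n)` has no zero outside the closed unit disc for large `n`, neither has the leading
coefficient of `P`. -/
theorem norm_le_one_of_leadingCoeff_zero (hP : P ≠ 0)
    (h : ∀ᶠ n : ℕ in atTop, ∀ z : ℂ, aeval z (P.eval (X ^ n : ℤ[X])) = 0 → ‖z‖ ≤ 1)
    {y : ℂ} (hy : aeval y P.leadingCoeff = 0) : ‖y‖ ≤ 1 := by
  by_contra! hy1
  set D := P.natDegree with hD
  -- `G(x, u) = u^D P(x, 1/u)` is the reversed polynomial. For `|z| > 1` one has `z^{-n} → 0`, so
  -- `z^{-nD} P(z, z^n) = G(z, z^{-n})` tends to the leading coefficient at `z`, and Hurwitz's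
  -- theorem applies.
  set G : ℂ × ℂ → ℂ := fun p =>
    ∑ i ∈ Finset.range (D + 1), aeval p.1 (P.coeff i) * p.2 ^ (D - i) with hG
  have hGcont : Continuous G := by fun_prop
  have hG0 : ∀ z, G (z, 0) = aeval z P.leadingCoeff := by
    intro z
    simp only [hG]
    rw [Finset.sum_range_succ, Finset.sum_eq_zero]
    · simp [hD]
    · intro i hi
      rw [Finset.mem_range] at hi
      rw [zero_pow (by omega), mul_zero]
  have hGQ : ∀ (n : ℕ) (z : ℂ), z ≠ 0 →
      G (z, z⁻¹ ^ n) * z ^ (n * D) = aeval z (P.eval (X ^ n : ℤ[X])) := by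
    intro n z hz
    rw [eval_eq_sum_range, map_sum, Finset.sum_mul]
    refine Finset.sum_congr rfl fun i hi => ?_
    obtain ⟨j, hj⟩ : ∃ j, D = i + j :=
      Nat.exists_eq_add_of_le (Nat.lt_succ_iff.1 (Finset.mem_range.1 hi))
    have : D - i = j := by omega
    simp only [map_mul, map_pow, aeval_X]
    rw [this, mul_assoc, hj, inv_pow, inv_pow, ← pow_mul, mul_add, pow_add, ← pow_mul]
    field_simp
  have hU : IsOpen {z : ℂ | 1 < ‖z‖} := isOpen_lt continuous_const continuous_norm
  have hne : ∀ z ∈ {z : ℂ | 1 < ‖z‖}, z ≠ 0 := by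
    rintro z hz rfl
    simp only [Set.mem_ofPred_eq, norm_zero] at hz
    linarith
  have key := eventually_exists_zero_of_tendsto hU (f := fun z => aeval z P.leadingCoeff)
    (F := fun n z => G (z, z⁻¹ ^ n)) (Eventually.of_forall fun n => ?_) ?_ hy1 ?_ hy ?_
  · obtain ⟨n, h1, z, hz, hz0⟩ := (h.and key).exists
    have := h1 z (by rw [← hGQ n z (hne z hz), hz0, zero_mul])
    exact absurd hz (not_lt.2 this)
  · simp only [hG]
    refine DifferentiableOn.fun_sum fun i _ => ?_
    refine (Polynomial.differentiable_aeval _).differentiableOn.mul (DifferentiableOn.pow ?_ _)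
    exact (differentiableOn_inv.mono fun z hz => hne z hz).pow _
  · intro z hz
    rw [← hG0]
    refine (hGcont.tendsto (z, 0)).comp (tendsto_snd.prodMk_nhds ?_)
    -- A radius strictly between `1` and `|z|` gives the decay `r^{-n}` uniformly near `z`.
    obtain ⟨r, hr1, hrz⟩ := exists_between (show (1 : ℝ) < ‖z‖ from hz)
    have hr0 : 0 < r := zero_lt_one.trans hr1
    have h1 : Tendsto (fun p : ℕ × ℂ => r⁻¹ ^ p.1) (atTop ×ˢ 𝓝 z) (𝓝 0) :=
      (tendsto_pow_atTop_nhds_zero_of_lt_one (by positivity) (inv_lt_one_of_one_lt₀ hr1)).comp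
        tendsto_fst
    refine squeeze_zero_norm' ?_ h1
    have h2 : ∀ᶠ p : ℕ × ℂ in atTop ×ˢ 𝓝 z, r < ‖p.2‖ :=
      tendsto_snd.eventually (continuous_norm.continuousAt.eventually_const_lt hrz)
    filter_upwards [h2] with p hp
    rw [norm_pow, norm_inv]
    gcongr
  · exact fun z _ => (Polynomial.differentiable_aeval _).analyticAt z
  · intro h0
    exact (infinite_of_mem_nhds y h0) (finite_zeros (leadingCoeff_ne_zero.2 hP))

/-- If `P(z, z ^ n)` has no zero outside the closed unit disc for large `n`, then for `|y| = 1` the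
roots of `P(y, ·)` lie in the closed unit disc. -/
theorem norm_le_one_of_specialize_root
    (h : ∀ᶠ n : ℕ in atTop, ∀ z : ℂ, aeval z (P.eval (X ^ n : ℤ[X])) = 0 → ‖z‖ ≤ 1)
    (θ : ℝ) (hy : specialize P (circleMap 0 1 θ) ≠ 0) {t : ℂ}
    (ht : (specialize P (circleMap 0 1 θ)).eval t = 0) : ‖t‖ ≤ 1 := by
  by_contra! ht1
  set y := circleMap 0 1 θ with hydef
  have ht0 : t ≠ 0 := by
    rintro rfl
    simp only [norm_zero] at ht1
    linarith
  -- Since `2πk_n/n → θ`, the points `Y n w = exp((w + 2πi k_n)/n)` tend to `y`, while `(Y n w)^n =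
  -- e^w` exactly. Hence `P(z, z^n)` at `z = Y n w` tends to `P(y, e^w)`, and a zero with `Re w > 0`
  -- would give `|Y n w| > 1`.
  set k : ℕ → ℤ := fun n => ⌊n * θ / (2 * Real.pi)⌋ with hk
  set Y : ℕ → ℂ → ℂ := fun n w => Complex.exp (w / n + (2 * Real.pi * k n / n : ℝ) * Complex.I)
    with hY
  set w₀ := Complex.log t with hw₀
  have hw : Complex.exp w₀ = t := Complex.exp_log ht0
  have hre : 0 < w₀.re := by
    rw [hw₀, Complex.log_re]
    exact Real.log_pos ht1
  have hU : IsOpen {w : ℂ | 0 < w.re} := isOpen_lt continuous_const Complex.continuous_re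
  have hYpow : ∀ (n : ℕ), n ≠ 0 → ∀ w, Y n w ^ n = Complex.exp w := by
    intro n hn w
    simp only [hY]
    rw [← Complex.exp_nat_mul, Complex.exp_eq_exp_iff_exists_int]
    refine ⟨k n, ?_⟩
    have : (n : ℂ) ≠ 0 := Nat.cast_ne_zero.2 hn
    push_cast
    field_simp
  have hang : Tendsto (fun n : ℕ => 2 * Real.pi * k n / n) atTop (𝓝 θ) := by
    have h1 : Tendsto (fun n : ℕ => (⌊(θ / (2 * Real.pi)) * n⌋ : ℝ) / n) atTop
        (𝓝 (θ / (2 * Real.pi))) := by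
      have h2 : Tendsto (fun n : ℕ => θ / (2 * Real.pi) - (n : ℝ)⁻¹) atTop
          (𝓝 (θ / (2 * Real.pi) - 0)) :=
        tendsto_const_nhds.sub tendsto_inv_atTop_nhds_zero_nat
      rw [sub_zero] at h2
      refine tendsto_of_tendsto_of_tendsto_of_le_of_le' h2 tendsto_const_nhds ?_ ?_
      · filter_upwards [eventually_gt_atTop 0] with n hn
        have hn' : (0 : ℝ) < n := Nat.cast_pos.2 hn
        rw [le_div_iff₀ hn', sub_mul, inv_mul_cancel₀ hn'.ne']
        exact (Int.sub_one_lt_floor _).le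
      · filter_upwards [eventually_gt_atTop 0] with n hn
        have hn' : (0 : ℝ) < n := Nat.cast_pos.2 hn
        rw [div_le_iff₀ hn']
        exact Int.floor_le _
    have h2 := h1.const_mul (2 * Real.pi)
    have h3 : 2 * Real.pi * (θ / (2 * Real.pi)) = θ := by
      have := Real.pi_pos
      field_simp
    rw [h3] at h2
    refine h2.congr fun n => ?_
    simp only [hk]
    rw [← mul_div_assoc, div_mul_eq_mul_div, mul_comm θ]
  have hYlim : ∀ w, Tendsto (fun p : ℕ × ℂ => Y p.1 p.2) (atTop ×ˢ 𝓝 w) (𝓝 y) := by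
    intro w
    have h1 : Tendsto (fun p : ℕ × ℂ => p.2 / p.1) (atTop ×ˢ 𝓝 w) (𝓝 (w * 0)) := by
      simp only [div_eq_mul_inv]
      refine tendsto_snd.mul ?_
      exact (tendsto_inv_atTop_nhds_zero_nat (𝕜 := ℂ)).comp tendsto_fst
    have h2 : Tendsto (fun p : ℕ × ℂ => ((2 * Real.pi * k p.1 / p.1 : ℝ) : ℂ) * Complex.I)
        (atTop ×ˢ 𝓝 w) (𝓝 ((θ : ℂ) * Complex.I)) :=
      ((Complex.continuous_ofReal.tendsto θ).comp (hang.comp tendsto_fst)).mul_const _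
    have h3 := (Complex.continuous_exp.tendsto _).comp (h1.add h2)
    rw [mul_zero, zero_add] at h3
    have h4 : y = Complex.exp (θ * Complex.I) := by simp [hydef, circleMap]
    rw [h4]
    exact h3
  set G : ℂ × ℂ → ℂ := fun p => (specialize P p.1).eval p.2 with hG
  have hGcont : Continuous G := continuous_eval_specialize P
  have key := eventually_exists_zero_of_tendsto hU (f := fun w => G (y, Complex.exp w))
    (F := fun n w => aeval (Y n w) (P.eval (X ^ n : ℤ[X]))) (Eventually.of_forall fun n => ?_) ?_
    hre ?_ (by simp only [hG, hw, ht]) ?_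
  · obtain ⟨n, ⟨h1, hn⟩, w, hwU, hw0⟩ := ((h.and (eventually_gt_atTop 0)).and key).exists
    have h2 := h1 _ hw0
    simp only [hY] at h2
    rw [Complex.norm_exp, Real.exp_le_one_iff] at h2
    have h3 : 0 < w.re / n := div_pos hwU (Nat.cast_pos.2 hn)
    simp [Complex.div_natCast_re] at h2
    linarith
  · have h1 : Differentiable ℂ (Y n) := by
      simp only [hY]
      fun_prop
    exact ((Polynomial.differentiable_aeval (P.eval (X ^ n : ℤ[X]))
      (𝕜 := ℂ)).comp h1).differentiableOn
  · intro w _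
    have h1 : Tendsto (fun p : ℕ × ℂ => G (Y p.1 p.2, Complex.exp p.2)) (atTop ×ˢ 𝓝 w)
        (𝓝 (G (y, Complex.exp w))) :=
      (hGcont.tendsto _).comp ((hYlim w).prodMk_nhds
        ((Complex.continuous_exp.tendsto w).comp tendsto_snd))
    refine h1.congr' ?_
    have h2 : ∀ᶠ p : ℕ × ℂ in atTop ×ˢ 𝓝 w, p.1 ≠ 0 :=
      tendsto_fst.eventually (eventually_ne_atTop 0)
    filter_upwards [h2] with p hp
    rw [aeval_eval_X_pow, hYpow _ hp]
  · intro w _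
    exact ((Polynomial.differentiable (specialize P y)).comp
      Complex.differentiable_exp).analyticAt w
  · intro h0
    -- A ball of radius `1` has diameter less than `2π`, so `exp` is injective on it and the limit
    -- function has only finitely many zeros near `w₀`.
    have hinj : Set.InjOn Complex.exp (Complex.exp ⁻¹' {z | (specialize P y).eval z = 0} ∩
        Metric.ball w₀ 1) := by
      intro a ha b hb hab
      obtain ⟨m, hm⟩ := Complex.exp_eq_exp_iff_exists_int.1 hab
      have h1 : dist a b < 2 := by
        have := dist_triangle_right a b w₀
        have h2 := Metric.mem_ball.1 ha.2
        have h3 := Metric.mem_ball.1 hb.2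
        linarith
      have h2 : ‖(m : ℂ) * (2 * Real.pi * Complex.I)‖ < 2 := by
        rwa [dist_eq_norm, hm, add_sub_cancel_left] at h1
      have h3 : |(m : ℝ)| * (2 * Real.pi) < 2 := by
        simpa [abs_of_pos Real.pi_pos] using h2
      have h4 : m = 0 := by
        by_contra hm0
        have h5 : (1 : ℝ) ≤ |(m : ℝ)| := by exact_mod_cast Int.one_le_abs hm0
        have := Real.pi_gt_three
        nlinarith
      rw [hm, h4]
      simp
    have hfin : {z : ℂ | (specialize P y).eval z = 0}.Finite := by
      refine (specialize P y).roots.toFinset.finite_toSet.subset fun z hz => ?_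
      simpa [hy] using hz
    have hfin2 : (Complex.exp ⁻¹' {z | (specialize P y).eval z = 0} ∩
        Metric.ball w₀ 1).Finite := by
      refine Set.Finite.of_finite_image (f := Complex.exp) (hfin.subset ?_) hinj
      rintro _ ⟨z, hz, rfl⟩
      exact hz.1
    exact infinite_of_mem_nhds w₀ (inter_mem h0 (Metric.ball_mem_nhds w₀ one_pos)) hfin2

/-- If `P(z, z ^ n)` has Mahler measure one for all large `n`, then so has `P`. -/
theorem logMahler₂_eq_zero_of_eventually (hP : P ≠ 0)
    (h : ∀ᶠ n : ℕ in atTop, logMahler (P.eval (X ^ n : ℤ[X])) = 0) : logMahler₂ P = 0 := by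
  have hb0 : P.leadingCoeff ≠ 0 := leadingCoeff_ne_zero.2 hP
  have hroots : ∀ᶠ n : ℕ in atTop,
      ∀ z : ℂ, aeval z (P.eval (X ^ n : ℤ[X])) = 0 → ‖z‖ ≤ 1 := by
    filter_upwards [h, eventually_eval_X_pow_ne_zero hP] with n h1 h2 z hz
    exact norm_le_one_of_logMahler_eq_zero h2 h1 hz
  -- An integral polynomial of Mahler measure one has leading coefficient `±1`, and for large `n`
  -- the leading coefficient of `P(z, z^n)` is that of `P.leadingCoeff`.
  have hlc : ‖(P.leadingCoeff.map (Int.castRingHom ℂ)).leadingCoeff‖ = 1 := by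
    obtain ⟨n, h1, h2⟩ := (h.and (eventually_natDegree_coeff_lt P)).exists
    obtain ⟨-, h3⟩ := natDegree_eval_X_pow hP h2
    have h4 : P.eval (X ^ n : ℤ[X]) ≠ 0 := by
      intro h4
      rw [h4, leadingCoeff_zero] at h3
      exact leadingCoeff_ne_zero.2 hb0 h3.symm
    have := norm_leadingCoeff_eq_one_of_mahlerMeasure_eq_one
      (mahlerMeasure_eq_one_of_logMahler_eq_zero h4 h1)
    rw [leadingCoeff_map_of_injective (Int.castRingHom ℂ).injective_int] at this ⊢
    rwa [h3] at this
  have hposLog : ∀ (p : ℂ[X]), (∀ z, p.eval z = 0 → p ≠ 0 → ‖z‖ ≤ 1) →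
      p.logMahlerMeasure = Real.log ‖p.leadingCoeff‖ := by
    intro p hp
    rw [logMahlerMeasure_eq_log_leadingCoeff_add_sum_log_roots, Multiset.sum_eq_zero, add_zero]
    intro x hx
    obtain ⟨a, ha, rfl⟩ := Multiset.mem_map.1 hx
    rw [Real.posLog_eq_zero_iff, abs_norm]
    exact hp a (isRoot_of_mem_roots ha) (ne_zero_of_mem_roots ha)
  have hb : logMahler P.leadingCoeff = 0 := by
    rw [logMahler, hposLog, hlc, Real.log_one]
    intro z hz _
    rw [eval_map] at hz
    exact norm_le_one_of_leadingCoeff_zero hP hroots hz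
  -- For almost every `x` on the circle no root of `P(x, ·)` contributes to Jensen's formula, so the
  -- two-variable measure reduces to that of the leading coefficient.
  rw [← hb, logMahler₂, logMahler, logMahlerMeasure_def, Real.circleAverage_def,
    Real.circleAverage_def]
  congr 1
  refine intervalIntegral.integral_congr_ae ?_
  filter_upwards [ae_aeval_circleMap_ne_zero hb0] with θ hθ _
  rw [hposLog, leadingCoeff_specialize hθ, eval_map]
  · rfl
  · exact fun z hz hp => norm_le_one_of_specialize_root hroots θ hp hz

/-! ### Gaps in the set of Mahler measures -/

/-- `logMahler` is additive and nonnegative, so one factor above the gap suffices. The extension to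
reducible polynomials is needed because `P(z^n, z)` need not be irreducible. -/
theorem logMahler_eq_zero_or_le {c : ℝ}
    (h : ∀ Q : ℤ[X], Irreducible Q → logMahler Q = 0 ∨ c ≤ logMahler Q) {Q : ℤ[X]} (hQ : Q ≠ 0) :
    logMahler Q = 0 ∨ c ≤ logMahler Q := by
  induction Q using UniqueFactorizationMonoid.induction_on_prime with
  | h₁ => exact absurd rfl hQ
  | h₂ u hu =>
    left
    obtain ⟨r, hr, rfl⟩ := isUnit_iff.1 hu
    rw [logMahler, map_C, logMahlerMeasure_const]
    rcases Int.isUnit_iff.1 hr with rfl | rfl <;> simp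
  | h₃ a p ha hp ih =>
    rw [logMahler_mul hp.ne_zero ha]
    have h1 := logMahler_nonneg ha
    have h2 := logMahler_nonneg hp.ne_zero
    rcases ih ha with h3 | h3 <;> rcases h p hp.irreducible with h4 | h4
    · left; linarith
    · right; linarith
    · right; linarith
    · right; linarith

/-- A gap above zero in the set of Mahler measures of integral polynomials in one variable is a gap
in the set of Mahler measures of integral polynomials in two variables. -/
theorem logMahler₂_eq_zero_or_le {c : ℝ}
    (h : ∀ Q : ℤ[X], Irreducible Q → logMahler Q = 0 ∨ c ≤ logMahler Q) (hP : P ≠ 0) :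
    logMahler₂ P = 0 ∨ c ≤ logMahler₂ P := by
  by_contra! hcon
  obtain ⟨hne, hlt⟩ := hcon
  have hsw : Bivariate.swap P ≠ 0 := by simpa using hP
  refine hne ?_
  rw [← logMahler₂_swap hP]
  refine logMahler₂_eq_zero_of_eventually hsw ?_
  have hlim : Tendsto (fun n : ℕ => logMahler₂ P + P.natDegree * Real.log 2 / n) atTop
      (𝓝 (logMahler₂ P + 0)) :=
    tendsto_const_nhds.add (tendsto_const_div_atTop_nhds_zero_nat _)
  rw [add_zero] at hlim
  -- For large `n` the error term fits below `c`, so the one-variable gap forces the value zero.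
  filter_upwards [hlim.eventually_lt_const hlt, eventually_eval_X_pow_ne_zero hsw,
    eventually_ne_atTop 0] with n h1 h2 h3
  refine (logMahler_eq_zero_or_le h h2).resolve_right (not_le.2 (lt_of_le_of_lt ?_ h1))
  refine logMahler_le_of_eval_eq hP h2 h3 fun z => ?_
  rw [aeval_eval_X_pow, eval_specialize_swap]

end Analysis

/-! ### Extensions of an absolute value and embeddings -/

section Abstract

variable {K L k E A : Type} [Field K] [Field L] [Algebra K L]
  [NormedField k] [Algebra K k]
  [NormedField E] [NormedAlgebra k E] [Algebra K E] [IsScalarTower K k E]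
  [Algebra L E] [IsScalarTower K L E]

/-- A finite-dimensional subspace over a complete nontrivially normed field is closed, and `k(α)`
contains the dense image of `L`. -/
theorem adjoin_eq_top_of_denseRange [CompleteSpace k] (hk : ∃ x : k, x ≠ 0 ∧ ‖x‖ ≠ 1)
    (hL : DenseRange (algebraMap L E)) {α : L} (hint : IsIntegral K α)
    (hα : ∀ x : L, ∃ p : K[X], aeval α p = x) :
    IsIntegral k (algebraMap L E α) ∧ k⟮algebraMap L E α⟯ = ⊤ := by
  let := NontriviallyNormedField.ofNormNeOne hk
  have h1 : IsIntegral k (algebraMap L E α) := (hint.map (IsScalarTower.toAlgHom K L E)).tower_top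
  refine ⟨h1, ?_⟩
  have : FiniteDimensional k k⟮algebraMap L E α⟯ := adjoin.finiteDimensional h1
  have hclosed : IsClosed (k⟮algebraMap L E α⟯ : Set E) :=
    Submodule.closed_of_finiteDimensional (k⟮algebraMap L E α⟯.toSubalgebra.toSubmodule)
  have hsub : Set.range (algebraMap L E) ⊆ (k⟮algebraMap L E α⟯ : Set E) := by
    rintro _ ⟨x, rfl⟩
    obtain ⟨p, rfl⟩ := hα x
    rw [← aeval_algebraMap_apply, ← aeval_map_algebraMap k]
    exact algebra_adjoin_le_adjoin k _ (aeval_mem_adjoin_singleton k _)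
  have hdense : Dense (k⟮algebraMap L E α⟯ : Set E) := Dense.mono hsub hL
  refine SetLike.coe_injective ?_
  rw [← hclosed.closure_eq, hdense.closure_eq]
  rfl

variable [NormedField A] [NormedAlgebra k A] [Algebra K A] [IsScalarTower K k A]

/-- An isometric embedding of `L` in a field containing `k` maps `α` to a root of the minimal
polynomial of `α` over the completion `k` of `K`. -/
theorem norm_aeval_eq_of_isometric (hK : DenseRange (algebraMap K k)) {α : L} (σ : L →ₐ[K] A)
    (hσ : ∀ x, ‖σ x‖ = ‖algebraMap L E x‖) (p : k[X]) :
    ‖aeval (σ α) p‖ = ‖aeval (algebraMap L E α) p‖ := by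
  set m := p.natDegree + 1
  -- Both norms are continuous in the coefficients and agree when these lie in the dense subfield
  -- `K`.
  let Φ : (Fin m → k) → ℝ := fun c => ‖∑ i, c i • (σ α) ^ (i : ℕ)‖
  let Ψ : (Fin m → k) → ℝ := fun c => ‖∑ i, c i • (algebraMap L E α) ^ (i : ℕ)‖
  have hd : DenseRange (Pi.map fun (_ : Fin m) => algebraMap K k) := DenseRange.piMap fun _ => hK
  have hΦΨ : Φ = Ψ := by
    refine hd.equalizer (by fun_prop) (by fun_prop) ?_
    ext c
    have h1 : ∑ i, algebraMap K k (c i) • (σ α) ^ (i : ℕ) = σ (∑ i, c i • α ^ (i : ℕ)) := by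
      rw [map_sum]
      refine Finset.sum_congr rfl fun i _ => ?_
      rw [map_smul, map_pow, algebraMap_smul]
    have h2 : ∑ i, algebraMap K k (c i) • (algebraMap L E α) ^ (i : ℕ) =
        algebraMap L E (∑ i, c i • α ^ (i : ℕ)) := by
      rw [map_sum]
      refine Finset.sum_congr rfl fun i _ => ?_
      rw [algebraMap_smul, Algebra.smul_def, Algebra.smul_def, map_mul, map_pow,
        ← IsScalarTower.algebraMap_apply K L E]
    simp only [Function.comp, Φ, Ψ, Pi.map_apply]
    rw [h1, h2, hσ]
  have h3 := congrFun hΦΨ fun i => p.coeff i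
  simp only [Φ, Ψ] at h3
  rw [aeval_eq_sum_range, aeval_eq_sum_range, ← Fin.sum_univ_eq_sum_range
    (fun i => p.coeff i • (σ α) ^ i), ← Fin.sum_univ_eq_sum_range
    (fun i => p.coeff i • (algebraMap L E α) ^ i)]
  exact h3

/-- The number of isometric embeddings of `L` in `A` is the degree of the completion of `L` over
that of `K`. -/
theorem card_isometric_embeddings [CompleteSpace k] [CharZero k] [IsAlgClosed A]
    (hk : ∃ x : k, x ≠ 0 ∧ ‖x‖ ≠ 1)
    (hK : DenseRange (algebraMap K k)) (hL : DenseRange (algebraMap L E))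
    {α : L} (hint : IsIntegral K α) (hα : ∀ x : L, ∃ p : K[X], aeval α p = x)
    (hU : FiniteDimensional k E → ∀ (τ : E →ₐ[k] A) (x : E), ‖τ x‖ = ‖x‖) :
    Nat.card {σ : L →ₐ[K] A // ∀ x, ‖σ x‖ = ‖algebraMap L E x‖} = Module.finrank k E ∧
      0 < Module.finrank k E := by
  obtain ⟨h1, htop⟩ := adjoin_eq_top_of_denseRange (k := k) hk hL hint hα
  have : FiniteDimensional k E := by
    have := adjoin.finiteDimensional h1
    rw [htop] at this
    exact Module.Finite.equiv (topEquiv (F := k) (E := E)).toLinearEquiv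
  have hsep : Algebra.IsSeparable k E := inferInstance
  refine ⟨?_, Module.finrank_pos⟩
  rw [← AlgHom.card k E A, ← Nat.card_eq_fintype_card]
  symm
  -- Restriction to `L`. It is injective because `α` generates `E`; it is surjective because an
  -- isometric `σ` sends `α` to a root of its minimal polynomial over `k`, hence extends to `E`.
  let r : (E →ₐ[k] A) → {σ : L →ₐ[K] A // ∀ x, ‖σ x‖ = ‖algebraMap L E x‖} := fun τ =>
    ⟨(τ.restrictScalars K).comp (IsScalarTower.toAlgHom K L E), fun x => hU inferInstance τ _⟩
  have hr : ∀ τ x, (r τ).1 x = τ (algebraMap L E x) := fun τ x => rfl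
  refine Nat.card_congr (Equiv.ofBijective r ⟨fun τ₁ τ₂ h => ?_, fun σ => ?_⟩)
  · have h2 : τ₁ (algebraMap L E α) = τ₂ (algebraMap L E α) := by
      rw [← hr, ← hr, h]
    ext x
    have hx : x ∈ k⟮algebraMap L E α⟯ := by rw [htop]; trivial
    have hx' : x ∈ Algebra.adjoin k {algebraMap L E α} := by
      rwa [← adjoin_simple_toSubalgebra_of_isAlgebraic h1.isAlgebraic, mem_toSubalgebra]
    rw [Algebra.adjoin_singleton_eq_range_aeval] at hx'
    obtain ⟨p, rfl⟩ := hx'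
    change τ₁ (aeval _ p) = τ₂ (aeval _ p)
    rw [← aeval_algHom_apply, ← aeval_algHom_apply, h2]
  · have h2 : aeval (σ.1 α) (minpoly k (algebraMap L E α)) = 0 := by
      rw [← norm_eq_zero, norm_aeval_eq_of_isometric (E := E) hK σ.1 σ.2, minpoly.aeval, norm_zero]
    obtain ⟨τ, hτ⟩ := exists_algHom_of_splits_of_aeval (F := k) (E := E) (K := A)
      (fun s => ⟨IsIntegral.of_finite k s, IsAlgClosed.splits _⟩) h2
    refine ⟨τ, Subtype.ext (AlgHom.ext fun x => ?_)⟩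
    obtain ⟨p, rfl⟩ := hα x
    rw [← aeval_algHom_apply, ← aeval_algHom_apply, hr, hτ]

end Abstract

/-! ### Completions of a finite extension and local degrees -/

section Completion

variable {K L : Type} [Field K] [Field L] [Algebra K L]

theorem apply_algebraMap_of_liesOver {v : AbsoluteValue K ℝ} {w : AbsoluteValue L ℝ}
    (h : w.LiesOver v) (x : K) : w (algebraMap K L x) = v x := by
  exact DFunLike.congr_fun h.comp_eq x

theorem isometry_map_of_liesOver {v : AbsoluteValue K ℝ} {w : AbsoluteValue L ℝ}
    (h : w.LiesOver v) : Isometry (WithAbs.map v w (algebraMap K L)) := by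
  refine AddMonoidHomClass.isometry_of_norm _ fun x => ?_
  rw [WithAbs.norm_eq_apply_ofAbs, WithAbs.norm_eq_apply_ofAbs]
  exact apply_algebraMap_of_liesOver h _

/-- The map of completions induced by an extension of absolute values. -/
def completionMap {v : AbsoluteValue K ℝ} {w : AbsoluteValue L ℝ} (h : w.LiesOver v) :
    v.Completion →+* w.Completion :=
  (isometry_map_of_liesOver h).mapRingHom

theorem norm_completionMap {v : AbsoluteValue K ℝ} {w : AbsoluteValue L ℝ} (h : w.LiesOver v)
    (x : v.Completion) : ‖completionMap h x‖ = ‖x‖ :=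
  (isometry_map_of_liesOver h).isometry_mapRingHom.norm_map_of_map_zero (map_zero _) x

theorem completionMap_coe {v : AbsoluteValue K ℝ} {w : AbsoluteValue L ℝ} (h : w.LiesOver v)
    (x : K) : completionMap h (algebraMap K v.Completion x) =
      algebraMap L w.Completion (algebraMap K L x) :=
  (isometry_map_of_liesOver h).mapRingHom_coe _

theorem denseRange_algebraMap_completion (v : AbsoluteValue K ℝ) :
    DenseRange (algebraMap K v.Completion) :=
  (UniformSpace.Completion.denseRange_coe (α := WithAbs v)).comp
    (WithAbs.toAbs_surjective v).denseRange (UniformSpace.Completion.continuous_coe _)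

theorem norm_algebraMap_completion (v : AbsoluteValue K ℝ) (x : K) :
    ‖algebraMap K v.Completion x‖ = v x :=
  (UniformSpace.Completion.norm_coe (WithAbs.toAbs v x)).trans (WithAbs.norm_toAbs_eq v x)

/-- The normed algebra structure on the completion of `L` over that of `K`. -/
@[reducible]
def completionNormedAlgebra {v : AbsoluteValue K ℝ} {w : AbsoluteValue L ℝ} (h : w.LiesOver v) :
    NormedAlgebra v.Completion w.Completion where
  __ := (completionMap h).toAlgebra
  norm_smul_le x y := by
    change ‖completionMap h x * y‖ ≤ _
    rw [norm_mul, norm_completionMap]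

/-- The isometric image of a complete space is closed, so it is the closure of the image of `K`, the
base field used in `localDegree`. -/
theorem range_completionMap {v : AbsoluteValue K ℝ} {w : AbsoluteValue L ℝ} (h : w.LiesOver v) :
    (completionMap h).fieldRange =
      ((toCompletion w).comp (algebraMap K L)).fieldRange.topologicalClosure := by
  have hiso := (isometry_map_of_liesOver h).isometry_mapRingHom
  refine SetLike.coe_injective ?_
  change _ = closure (((toCompletion w).comp (algebraMap K L)).fieldRange : Set w.Completion)
  rw [RingHom.coe_fieldRange, RingHom.coe_fieldRange]
  refine subset_antisymm ?_ ?_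
  · refine (hiso.continuous.range_subset_closure_image_dense
      (denseRange_algebraMap_completion v)).trans (closure_mono ?_)
    rintro _ ⟨_, ⟨x, rfl⟩, rfl⟩
    exact ⟨x, (completionMap_coe h x).symm⟩
  · refine closure_minimal ?_ hiso.isClosedEmbedding.isClosed_range
    rintro _ ⟨x, rfl⟩
    exact ⟨algebraMap K v.Completion x, completionMap_coe h x⟩

theorem localDegree_eq_finrank {v : AbsoluteValue K ℝ} {w : AbsoluteValue L ℝ} (h : w.LiesOver v) :
    letI := completionNormedAlgebra h
    localDegree K w = Module.finrank v.Completion w.Completion := by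
  let := completionNormedAlgebra h
  rw [localDegree, ← range_completionMap h]
  symm
  exact Algebra.finrank_eq_of_equiv_equiv (RingEquiv.ofBijective (completionMap h).rangeRestrictField
    (RingHom.rangeRestrictField_bijective _)) (RingEquiv.refl _) (by ext; rfl)

/-- A sum over the absolute values of `L` extending `v`, as a sum over embeddings in an
algebraically closed extension of the completion of `K`. -/
theorem finsum_liesOver_eq_sum_embeddings [CharZero K] {v : AbsoluteValue K ℝ}
    (hv : ∃ x, x ≠ 0 ∧ v x ≠ 1) {A : Type} [NormedField A] [IsAlgClosed A]
    [NormedAlgebra v.Completion A] [Algebra K A] [IsScalarTower K v.Completion A]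
    {α : L} (hint : IsIntegral K α) (hα : ∀ x : L, ∃ p : K[X], aeval α p = x)
    [Fintype (L →ₐ[K] A)]
    (hU : ∀ (E : Type) [Field E] [Algebra v.Completion E] [FiniteDimensional v.Completion E]
      (u : AbsoluteValue E ℝ), (∀ x : v.Completion, u (algebraMap _ E x) = ‖x‖) →
      ∀ (τ : E →ₐ[v.Completion] A) (x : E), ‖τ x‖ = u x) (φ : ℝ → ℝ) :
    ∑ᶠ w : {w : AbsoluteValue L ℝ // w.LiesOver v}, (localDegree K w.1 : ℝ) * φ (w.1 α) =
      ∑ σ : L →ₐ[K] A, φ ‖σ α‖ := by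
  classical
  have hk : ∃ x : v.Completion, x ≠ 0 ∧ ‖x‖ ≠ 1 := by
    obtain ⟨x, hx0, hx1⟩ := hv
    exact ⟨algebraMap K _ x, (_root_.map_ne_zero _).2 hx0, by rwa [norm_algebraMap_completion]⟩
  have : CharZero v.Completion := charZero_of_injective_algebraMap (algebraMap K _).injective
  have hcard : ∀ w : {w : AbsoluteValue L ℝ // w.LiesOver v},
      Nat.card {σ : L →ₐ[K] A // ∀ x, ‖σ x‖ = w.1 x} = localDegree K w.1 ∧
        0 < localDegree K w.1 := by
    intro w
    let := completionNormedAlgebra w.2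
    have : IsScalarTower K L w.1.Completion := .of_algebraMap_eq fun x => rfl
    have : IsScalarTower K v.Completion w.1.Completion := .of_algebraMap_eq fun x =>
      (completionMap_coe w.2 x).symm
    rw [localDegree_eq_finrank w.2]
    have := card_isometric_embeddings (k := v.Completion) (E := w.1.Completion) (A := A) hk
      (denseRange_algebraMap_completion v) (denseRange_algebraMap_completion w.1) hint hα
      (fun _ τ x => hU w.1.Completion (NormedField.toAbsoluteValue _)
        (fun x => norm_completionMap w.2 x) τ x)
    simpa only [norm_algebraMap_completion] using this
  -- Pulling back the norm of `A` sorts the embeddings by place. The fibre over `w` has `localDegree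
  -- K w` elements, which is positive, so every place occurs and there are finitely many.
  let r : (L →ₐ[K] A) → {w : AbsoluteValue L ℝ // w.LiesOver v} := fun σ =>
    ⟨(NormedField.toAbsoluteValue A).comp (f := (σ : L →+* A)) σ.toRingHom.injective, ⟨by
      ext x
      change ‖σ (algebraMap K L x)‖ = v x
      rw [σ.commutes, IsScalarTower.algebraMap_apply K v.Completion A, norm_algebraMap',
        norm_algebraMap_completion]⟩⟩
  have hr : ∀ σ w, r σ = w ↔ ∀ x, ‖σ x‖ = w.1 x := by
    intro σ w
    rw [Subtype.ext_iff, AbsoluteValue.ext_iff]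
    rfl
  have hsurj : Function.Surjective r := by
    intro w
    have h1 := hcard w
    rw [← h1.1] at h1
    obtain ⟨⟨σ, hσ⟩⟩ := (Nat.card_pos_iff.1 h1.2).1
    exact ⟨σ, (hr σ w).2 hσ⟩
  have : Finite {w : AbsoluteValue L ℝ // w.LiesOver v} := Finite.of_surjective r hsurj
  let := Fintype.ofFinite {w : AbsoluteValue L ℝ // w.LiesOver v}
  rw [finsum_eq_sum_of_fintype, ← Finset.sum_fiberwise _ r]
  refine Finset.sum_congr rfl fun w _ => ?_
  rw [← (hcard w).1, Finset.sum_congr rfl (g := fun _ => φ (w.1 α)), Finset.sum_const, nsmul_eq_mul]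
  · congr 2
    rw [Nat.card_eq_fintype_card, Fintype.card_subtype]
    congr 1
    ext σ
    simp only [Finset.mem_filter, Finset.mem_univ, true_and, hr]
  · intro σ hσ
    rw [Finset.mem_filter] at hσ
    rw [(hr σ w).1 hσ.2]

end Completion

/-! ### Local heights -/

section Roots

variable {K : Type} [Field K] {Ω : Type} [Field Ω] [Algebra K Ω]

/-- In characteristic zero the minimal polynomial is separable, so its roots counted with
multiplicity correspond to the embeddings. -/
theorem sum_embeddings_eq_sum_aroots [CharZero K] {A : Type} [Field A] [IsAlgClosed A] [Algebra K A]
    {α : Ω} (hα : IsIntegral K α) [Fintype (K⟮α⟯ →ₐ[K] A)] (g : A → ℝ) :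
    ∑ σ : K⟮α⟯ →ₐ[K] A, g (σ (AdjoinSimple.gen K α)) = (((minpoly K α).aroots A).map g).sum := by
  classical
  have hnd : ((minpoly K α).aroots A).Nodup :=
    nodup_roots (minpoly.irreducible hα).separable.map
  rw [← Multiset.dedup_eq_self.2 hnd]
  change _ = ∑ x ∈ ((minpoly K α).aroots A).toFinset, g x
  rw [← Finset.sum_coe_sort ((minpoly K α).aroots A).toFinset g]
  have hmem : ∀ x, x ∈ (minpoly K α).aroots A ↔ x ∈ ((minpoly K α).aroots A).toFinset :=
    fun x => Multiset.mem_toFinset.symm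
  refine Fintype.sum_equiv ((algHomAdjoinIntegralEquiv K hα).trans
    (Equiv.subtypeEquivRight hmem)) _ _ fun σ => ?_
  obtain ⟨x, rfl⟩ := (algHomAdjoinIntegralEquiv K hα).symm.surjective σ
  rw [algHomAdjoinIntegralEquiv_symm_apply_gen]
  simp

theorem exists_aeval_gen_eq {α : Ω} (hα : IsIntegral K α) (x : K⟮α⟯) :
    ∃ p : K[X], aeval (AdjoinSimple.gen K α) p = x := by
  have hx := x.2
  rw [← mem_toSubalgebra, adjoin_simple_toSubalgebra_of_isAlgebraic hα.isAlgebraic,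
    Algebra.adjoin_singleton_eq_range_aeval] at hx
  obtain ⟨p, hp⟩ := hx
  refine ⟨p, Subtype.ext ?_⟩
  rw [← hp, ← aeval_coe]
  rfl

theorem fiberAverage_eq {v : AbsoluteValue K ℝ} {α : Ω} (hα : IsIntegral K α) (φ : ℝ → ℝ) :
    fiberAverage v (fun w : AbsoluteValue K⟮α⟯ ℝ => φ (w (AdjoinSimple.gen K α))) =
      ((minpoly K α).natDegree : ℝ)⁻¹ *
        ∑ᶠ w : {w : AbsoluteValue K⟮α⟯ ℝ // w.LiesOver v},
          (localDegree K w.1 : ℝ) * φ (w.1 (AdjoinSimple.gen K α)) := by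
  rw [fiberAverage, ← smul_eq_mul (_⁻¹ : ℝ), smul_finsum, adjoin.finrank hα]
  refine finsum_congr fun w => ?_
  rw [smul_eq_mul]
  ring

/-- The local height over an archimedean place with completion `ℂ`. -/
theorem fiberAverage_of_complex [CharZero K] {v : AbsoluteValue K ℝ} (e : K →+* ℂ) (he : DenseRange e)
    (hv : ∀ x, v x = ‖e x‖) {α : Ω} (hα : IsIntegral K α) :
    fiberAverage v (fun w : AbsoluteValue K⟮α⟯ ℝ =>
        Real.log (max 1 (w (AdjoinSimple.gen K α)))) =
      ((minpoly K α).natDegree : ℝ)⁻¹ * ((minpoly K α).map e).logMahlerMeasure := by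
  have hiso : Isometry (e.comp (WithAbs.equiv v).toRingHom) :=
    AddMonoidHomClass.isometry_of_norm _ fun x => (hv x.ofAbs).symm
  set ι : v.Completion →+* ℂ := hiso.extensionHom with hι
  have hιcoe : ∀ x : K, ι (algebraMap K v.Completion x) = e x := fun x =>
    hiso.extensionHom_coe (WithAbs.toAbs v x)
  have hιcont : Continuous ι := UniformSpace.Completion.continuous_extension
  have hιnorm : ∀ x, ‖ι x‖ = ‖x‖ := by
    intro x
    refine congrFun (DenseRange.equalizer (denseRange_algebraMap_completion v)
      hιcont.norm continuous_norm ?_) x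
    ext y
    simp only [Function.comp]
    rw [hιcoe, norm_algebraMap_completion, hv]
  have hιiso : Isometry ι := AddMonoidHomClass.isometry_of_norm _ hιnorm
  -- The image is closed, being isometric to a complete space, and dense; hence the completion is
  -- `ℂ` itself.
  have hιsurj : Function.Surjective ι := by
    rw [← Set.range_eq_univ, ← hιiso.isClosedEmbedding.isClosed_range.closure_eq]
    refine Dense.closure_eq (Dense.mono ?_ he)
    rintro _ ⟨x, rfl⟩
    exact ⟨_, hιcoe x⟩
  have hclosed : IsAlgClosed v.Completion :=
    IsAlgClosed.of_ringEquiv ℂ _ (RingEquiv.ofBijective ι ⟨ι.injective, hιsurj⟩).symm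
  let _ : NormedAlgebra v.Completion ℂ :=
    { ι.toAlgebra with
      norm_smul_le := fun x y => by
        change ‖ι x * y‖ ≤ _
        rw [norm_mul, hιnorm] }
  let _ : Algebra K ℂ := e.toAlgebra
  have : IsScalarTower K v.Completion ℂ := .of_algebraMap_eq fun x => (hιcoe x).symm
  have : FiniteDimensional K K⟮α⟯ := adjoin.finiteDimensional hα
  let _ : Fintype (K⟮α⟯ →ₐ[K] ℂ) := Fintype.ofFinite _
  rw [fiberAverage_eq hα fun x => Real.log (max 1 x)]
  congr 1
  rw [finsum_liesOver_eq_sum_embeddings (A := ℂ) ⟨2, two_ne_zero, by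
      rw [hv, map_ofNat]
      norm_num⟩ (α := AdjoinSimple.gen K α) ((AdjoinSimple.isIntegral_gen K α).2 hα)
    (exists_aeval_gen_eq hα) ?_ fun x => Real.log (max 1 x)]
  · rw [sum_embeddings_eq_sum_aroots hα fun x => Real.log (max 1 ‖x‖),
      logMahlerMeasure_eq_log_leadingCoeff_add_sum_log_roots, (minpoly.monic hα).map e]
    simp only [norm_one, Real.log_one, zero_add]
    congr 1
    refine Multiset.map_congr rfl fun x _ => ?_
    rw [Real.posLog_eq_log_max_one (norm_nonneg x)]
  · intro E _ _ _ u hu τ x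
    -- A finite extension of an algebraically closed field is trivial.
    obtain ⟨c, rfl⟩ := (IsAlgClosed.algebraMap_bijective_of_isIntegral (k := v.Completion)
      (K := E)).2 x
    rw [τ.commutes, hu]
    exact hιnorm c

/-- The non-archimedean counterpart of Jensen's formula: the Gauss norm is multiplicative, and is
`max(1, |x|)` on a linear factor. -/
theorem gaussNorm_prod_X_sub_C {A : Type*} [Field A] {a : AbsoluteValue A ℝ}
    (hna : IsNonarchimedean a) (s : Multiset A) :
    ((s.map fun x => X - C x).prod).gaussNorm a 1 = (s.map fun x => max 1 (a x)).prod := by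
  have hlin : ∀ x : A, (X - C x).gaussNorm a 1 = max 1 (a x) := by
    intro x
    refine le_antisymm ?_ (max_le ?_ ?_)
    · obtain ⟨i, hi⟩ := (X - C x).exists_eq_gaussNorm a 1
      rw [hi, one_pow, mul_one]
      rcases i with _ | _ | i
      · simp
      · simp [coeff_X]
      · simp [coeff_X]
    · have h := (X - C x).le_gaussNorm a zero_le_one 1
      rwa [coeff_sub, coeff_X_one, coeff_C_succ, sub_zero, map_one, one_pow, mul_one] at h
    · have h := (X - C x).le_gaussNorm a zero_le_one 0
      rwa [coeff_sub, coeff_X_zero, coeff_C_zero, zero_sub, AbsoluteValue.map_neg, pow_zero,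
        mul_one] at h
  induction s using Multiset.induction_on with
  | empty =>
    simp only [Multiset.map_zero, Multiset.prod_zero]
    rw [← C_1, gaussNorm_C, map_one]
  | cons x s ih =>
    simp only [Multiset.map_cons, Multiset.prod_cons]
    rw [gaussNorm_mul hna one_pos, ih, hlin]

theorem sum_aroots_eq_log_gaussNorm {A : Type} [NormedField A] [IsAlgClosed A] [Algebra K A]
    (hA : IsNonarchimedean (fun x : A => ‖x‖)) {v : AbsoluteValue K ℝ}
    (hv : ∀ x, ‖algebraMap K A x‖ = v x) {p : K[X]} (hp : p.Monic) :
    ((p.aroots A).map fun x => Real.log (max 1 ‖x‖)).sum = Real.log (p.gaussNorm v 1) := by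
  set a : AbsoluteValue A ℝ := NormedField.toAbsoluteValue A with ha
  have hna : IsNonarchimedean a := hA
  have h1 : p.gaussNorm v 1 = (p.map (algebraMap K A)).gaussNorm a 1 := by
    have hs : (p.map (algebraMap K A)).support = p.support :=
      support_map_of_injective p (algebraMap K A).injective
    simp only [gaussNorm, hs, coeff_map]
    congr! 4
    exact (hv _).symm
  have h2 := (IsAlgClosed.splits (p.map (algebraMap K A))).eq_prod_roots
  rw [hp.map, C_1, one_mul] at h2
  rw [h1, h2, gaussNorm_prod_X_sub_C hna, Real.log_multiset_prod, Multiset.map_map]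
  · rfl
  · rintro x hx
    obtain ⟨b, -, rfl⟩ := Multiset.mem_map.1 hx
    positivity

/-- The algebraic closure of a complete non-archimedean field, with its norm. -/
theorem exists_algClosed_normedAlgebra {k : Type} [NormedField k] [CompleteSpace k]
    [IsUltrametricDist k] (hk : ∃ x : k, x ≠ 0 ∧ ‖x‖ ≠ 1) :
    ∃ (A : Type) (_ : NormedField A) (_ : NormedAlgebra k A), IsAlgClosed A ∧
      IsNonarchimedean (fun x : A => ‖x‖) ∧
      ∀ (E : Type) [Field E] [Algebra k E] [FiniteDimensional k E]
      (u : AbsoluteValue E ℝ), (∀ x : k, u (algebraMap _ E x) = ‖x‖) →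
      ∀ (τ : E →ₐ[k] A) (x : E), ‖τ x‖ = u x := by
  let _ := NontriviallyNormedField.ofNormNeOne hk
  refine ⟨AlgebraicClosure k, spectralNorm.normedField k _, spectralNorm.normedAlgebra k _,
    inferInstance, isNonarchimedean_spectralNorm, fun E _ _ _ u hu τ x => ?_⟩
  -- Over a complete field the extension of the norm is unique, and the spectral norm depends only
  -- on the minimal polynomial, which `τ` preserves.
  rw [spectralNorm_unique_field_norm_ext hu x]
  change spectralNorm k (AlgebraicClosure k) (τ x) = _
  rw [spectralNorm, spectralNorm, minpoly.algHom_eq τ τ.toRingHom.injective]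

theorem isUltrametricDist_completion {v : AbsoluteValue K ℝ} (hna : IsNonarchimedean v) :
    IsUltrametricDist v.Completion := by
  refine IsUltrametricDist.isUltrametricDist_of_forall_norm_add_le_max_norm fun x y => ?_
  induction x, y using UniformSpace.Completion.induction_on₂ with
  | hp => exact isClosed_le (by fun_prop) (by fun_prop)
  | ih x y =>
    rw [← UniformSpace.Completion.coe_add]
    simp only [UniformSpace.Completion.norm_coe]
    exact hna x.ofAbs y.ofAbs

/-- The local height over a non-archimedean place. -/
theorem fiberAverage_of_isNonarchimedean [CharZero K] {v : AbsoluteValue K ℝ} (hna : IsNonarchimedean v)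
    {α : Ω} (hα : IsIntegral K α) :
    fiberAverage v (fun w : AbsoluteValue K⟮α⟯ ℝ =>
        Real.log (max 1 (w (AdjoinSimple.gen K α)))) =
      ((minpoly K α).natDegree : ℝ)⁻¹ * Real.log ((minpoly K α).gaussNorm v 1) := by
  rw [fiberAverage_eq hα fun x => Real.log (max 1 x)]
  congr 1
  have : FiniteDimensional K K⟮α⟯ := adjoin.finiteDimensional hα
  by_cases hv : ∃ x, x ≠ 0 ∧ v x ≠ 1
  · have := isUltrametricDist_completion hna
    obtain ⟨A, _, _, hA, hAna, hU⟩ := exists_algClosed_normedAlgebra (k := v.Completion) (by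
      obtain ⟨x, hx0, hx1⟩ := hv
      exact ⟨algebraMap K _ x, (_root_.map_ne_zero _).2 hx0, by rwa [norm_algebraMap_completion]⟩)
    let _ : Algebra K A := ((algebraMap v.Completion A).comp (algebraMap K v.Completion)).toAlgebra
    have : IsScalarTower K v.Completion A := .of_algebraMap_eq fun x => rfl
    let _ : Fintype (K⟮α⟯ →ₐ[K] A) := Fintype.ofFinite _
    rw [finsum_liesOver_eq_sum_embeddings (A := A) hv (α := AdjoinSimple.gen K α)
      ((AdjoinSimple.isIntegral_gen K α).2 hα) (exists_aeval_gen_eq hα) hU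
      fun x => Real.log (max 1 x),
      sum_embeddings_eq_sum_aroots hα fun x => Real.log (max 1 ‖x‖)]
    refine sum_aroots_eq_log_gaussNorm hAna (fun x => ?_) (minpoly.monic hα)
    rw [IsScalarTower.algebraMap_apply K v.Completion A, norm_algebraMap',
      norm_algebraMap_completion]
  -- The trivial absolute value does occur: it belongs to the closed points with `H(x) = 1`. Every
  -- place above it is trivial too, and both sides vanish.
  · push Not at hv
    have hv1 : ∀ x, v x ≤ 1 := by
      intro x
      by_cases hx : x = 0
      · simp [hx]
      · exact (hv x hx).le
    have hg : (minpoly K α).gaussNorm v 1 = 1 := by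
      refine le_antisymm ?_ ?_
      · obtain ⟨i, hi⟩ := (minpoly K α).exists_eq_gaussNorm v 1
        rw [hi, one_pow, mul_one]
        exact hv1 _
      · have := (minpoly K α).le_gaussNorm v zero_le_one (minpoly K α).natDegree
        rwa [coeff_natDegree, minpoly.monic hα, map_one, one_pow, mul_one] at this
    rw [hg, Real.log_one]
    refine finsum_eq_zero_of_forall_eq_zero fun w => ?_
    -- An integral equation with coefficients of size at most `1` bounds `|b|^n` by a geometric sum,
    -- which is too small when `|b| ≥ 2`. Applied to all powers of the generator, the bound `2`
    -- improves to `1`.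
    have hlt : ∀ b : K⟮α⟯, w.1 b < 2 := by
      intro b
      by_contra! hb
      have hbint : IsIntegral K b := .of_finite K b
      have h1 : b ^ (minpoly K b).natDegree = -∑ i ∈ Finset.range (minpoly K b).natDegree,
          algebraMap K _ ((minpoly K b).coeff i) * b ^ i := by
        have h2 := minpoly.aeval K b
        rw [aeval_eq_sum_range, Finset.sum_range_succ, coeff_natDegree, minpoly.monic hbint,
          one_smul] at h2
        simp only [← Algebra.smul_def]
        exact eq_neg_of_add_eq_zero_right h2
      have h3 : w.1 b ^ (minpoly K b).natDegree ≤
          ∑ i ∈ Finset.range (minpoly K b).natDegree, w.1 b ^ i := by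
        rw [← map_pow, h1, map_neg_eq_map]
        refine (w.1.sum_le _ _).trans (Finset.sum_le_sum fun i _ => ?_)
        rw [map_mul, map_pow, apply_algebraMap_of_liesOver w.2]
        exact mul_le_of_le_one_left (pow_nonneg (w.1.nonneg _) _) (hv1 _)
      have h4 : ∀ n : ℕ, ∑ i ∈ Finset.range n, w.1 b ^ i < w.1 b ^ n := by
        intro n
        induction n with
        | zero => simp
        | succ n ih =>
          rw [Finset.sum_range_succ, pow_succ]
          have : 0 < w.1 b ^ n := by positivity
          nlinarith
      exact absurd (h4 _) (not_lt.2 h3)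
    have hle : w.1 (AdjoinSimple.gen K α) ≤ 1 := by
      by_contra! h
      obtain ⟨n, hn⟩ := pow_unbounded_of_one_lt 2 h
      rw [← map_pow] at hn
      exact absurd (hlt _) (not_lt.2 hn.le)
    rw [max_eq_left hle, Real.log_one, mul_zero]

end Roots

/-! ### Gauss norms of primitive polynomials -/

section Primitive

variable {R : Type} [CommRing R] {L : Type} [Field L] {v : AbsoluteValue L ℝ}

/-- If the Gauss norm were below `1`, the non-unit `m` would divide every coefficient of a primitive
polynomial. The hypotheses also cover trivial absolute values. -/
theorem gaussNorm_map_eq_one {f : R →+* L} (hle : ∀ r, v (f r) ≤ 1) {m : R}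
    (hm : ∀ r, v (f r) < 1 → m ∣ r) (hmu : ¬ IsUnit m) {P : R[X]} (hP : P.IsPrimitive) :
    (P.map f).gaussNorm v 1 = 1 := by
  apply le_antisymm
  · obtain ⟨i, hi⟩ := exists_eq_gaussNorm v 1 (P.map f)
    rw [hi, coeff_map, one_pow, mul_one]
    exact hle _
  · by_contra! h
    refine hmu (hP m ((C_dvd_iff_dvd_coeff _ _).2 fun i => hm _ ?_))
    have := le_gaussNorm v (P.map f) (zero_le_one (α := ℝ)) i
    rw [one_pow, mul_one, coeff_map] at this
    exact this.trans_lt h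

theorem gaussNorm_eq_inv_of_eq_mul_C (hna : IsNonarchimedean v) {f : R →+* L}
    (hle : ∀ r, v (f r) ≤ 1) {m : R} (hm : ∀ r, v (f r) < 1 → m ∣ r) (hmu : ¬ IsUnit m) {P : R[X]}
    (hP : P.IsPrimitive) {p : L[X]} (hp : p = P.map f * C (f P.leadingCoeff)⁻¹) :
    p.gaussNorm v 1 = (v (f P.leadingCoeff))⁻¹ := by
  rw [hp, gaussNorm_mul hna one_pos, gaussNorm_map_eq_one hle hm hmu hP, gaussNorm_C, map_inv₀,
    one_mul]

end Primitive

theorem minpoly_eq_map_mul_C {R K Ω : Type} [CommRing R] [IsDomain R] [NormalizedGCDMonoid R]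
    [Field K] [Algebra R K] [IsFractionRing R K] [Field Ω] [Algebra K Ω] {P : R[X]}
    (hP : Irreducible P) (hd : P.natDegree ≠ 0) {α : Ω} (hα : aeval α (P.map (algebraMap R K)) = 0) :
    minpoly K α = P.map (algebraMap R K) * C (algebraMap R K P.leadingCoeff)⁻¹ := by
  rw [← leadingCoeff_map_of_injective (IsFractionRing.injective R K)]
  exact (minpoly.eq_of_irreducible
    (((hP.isPrimitive hd).irreducible_iff_irreducible_map_fraction_map).1 hP) hα).symm

/-! ### The finite part of the height over a number field -/

section FiniteHeight

open NumberField

/-- The finite part of the multiplicative height. -/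
def finiteHeight (K : Type) [Field K] [NumberField K] (x : K) : ℝ :=
  ∏ᶠ v : FinitePlace K, max (v x) 1

variable {K : Type} [Field K] [NumberField K]

theorem hasFiniteMulSupport_max (x : K) :
    (fun v : FinitePlace K => max (v x) 1).HasFiniteMulSupport := by
  rcases eq_or_ne x 0 with rfl | hx
  · have : (fun v : FinitePlace K => max (v 0) 1) = fun _ => (1 : ℝ) := by
      funext v
      simp
    rw [this]
    simp [Function.HasFiniteMulSupport]
  · refine (FinitePlace.hasFiniteMulSupport hx).subset fun v hv => ?_
    rw [Function.mem_mulSupport] at hv ⊢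
    intro h
    exact hv (by rw [h, max_self])

/-- For `x = a/n` the product of `max(|a|_v, |n|_v)` over the finite places is the inverse norm of
the ideal `(a, n)`. Ideal norms make the behaviour under field extension visible. -/
theorem absNorm_mul_finiteHeight (x : K) (n a : 𝓞 K) (hn : n ≠ 0) (h : (n : K) * x = a) :
    (Ideal.span {a, n}).absNorm * finiteHeight K x = (Ideal.span {n}).absNorm := by
  have hn' : (n : K) ≠ 0 := by exact_mod_cast hn
  have h1 := absNorm_mul_finprod_finitePlace_eq_one (K := K) (x := ![a, n])
    (fun h0 => hn (by simpa using congrFun h0 1))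
  have h2 : ∀ v : FinitePlace K, (⨆ i, v ((![a, n] i : 𝓞 K) : K)) = v n * max (v x) 1 := by
    intro v
    have : (⨆ i, v ((![a, n] i : 𝓞 K) : K)) = max (v a) (v n) := by
      apply le_antisymm
      · apply ciSup_le
        intro i
        fin_cases i <;> simp
      · apply max_le
        · exact Finite.le_ciSup_of_le (0 : Fin 2) le_rfl
        · exact Finite.le_ciSup_of_le (1 : Fin 2) le_rfl
    rw [this, ← h, map_mul, mul_max_of_nonneg _ _ (apply_nonneg v _), mul_one]
  have h3 : (∏ᶠ v : FinitePlace K, v (n : K)) * (Ideal.span {n}).absNorm = 1 := by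
    rw [FinitePlace.prod_eq_inv_abs_norm_int hn, Ideal.absNorm_span_singleton]
    have : (Algebra.norm ℤ n : ℝ) ≠ 0 := by
      exact_mod_cast Algebra.norm_ne_zero_iff.2 hn
    rw [Nat.cast_natAbs, Int.cast_abs]
    exact inv_mul_cancel₀ (abs_ne_zero.2 this)
  rw [finprod_congr h2, finprod_mul_distrib (FinitePlace.hasFiniteMulSupport hn')
    (hasFiniteMulSupport_max x)] at h1
  rw [Matrix.range_cons, Matrix.range_cons, Matrix.range_empty, Set.union_empty,
    Set.singleton_union] at h1
  rw [finiteHeight]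
  linear_combination (Ideal.span {n}).absNorm * h1 -
    (Ideal.span {a, n}).absNorm * (∏ᶠ v : FinitePlace K, max (v x) 1) * h3

theorem finiteHeight_algebraMap {E : Type} [Field E] [NumberField E] [Algebra K E] (x : K) :
    finiteHeight E (algebraMap K E x) = finiteHeight K x ^ Module.finrank K E := by
  obtain ⟨a, n, hn, rfl⟩ := IsFractionRing.div_surjective (𝓞 K) x
  have hn := nonZeroDivisors.ne_zero hn
  have hn' : (n : K) ≠ 0 := by exact_mod_cast hn
  have e1 := absNorm_mul_finiteHeight _ n a hn (mul_div_cancel₀ (a : K) hn')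
  have hnE : algebraMap (𝓞 K) (𝓞 E) n ≠ 0 := by
    rw [Ne, FaithfulSMul.algebraMap_eq_zero_iff]; exact hn
  have e2 := absNorm_mul_finiteHeight (K := E) (algebraMap K E (a / n))
    (algebraMap (𝓞 K) (𝓞 E) n) (algebraMap (𝓞 K) (𝓞 E) a) hnE (by
      change algebraMap K E n * _ = algebraMap K E a
      rw [← map_mul, mul_div_cancel₀ (a : K) hn'])
  have m1 : Ideal.span {algebraMap (𝓞 K) (𝓞 E) a, algebraMap (𝓞 K) (𝓞 E) n} =
      (Ideal.span {a, n}).map (algebraMap (𝓞 K) (𝓞 E)) := by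
    rw [Ideal.map_span, Set.image_pair]
  have m2 : Ideal.span {algebraMap (𝓞 K) (𝓞 E) n} =
      (Ideal.span {n}).map (algebraMap (𝓞 K) (𝓞 E)) := by
    rw [Ideal.map_span, Set.image_singleton]
  rw [m1, m2, Ideal.absNorm_algebraMap, Ideal.absNorm_algebraMap,
    ← IsFractionRing.finrank_eq (𝓞 K) K (𝓞 E) E] at e2
  rw [Nat.cast_pow, Nat.cast_pow] at e2
  rw [← e1, mul_pow] at e2
  refine mul_left_cancel₀ (pow_ne_zero _ ?_) e2
  rw [Nat.cast_ne_zero, Ne, Ideal.absNorm_eq_zero_iff, Ideal.span_eq_bot]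
  exact fun h => hn (h n (by simp))

theorem finprod_multiset_map_prod {ι M : Type*} [CommMonoid M] {β : Type*} (s : Multiset β)
    (f : ι → β → M) (hf : ∀ b, (fun i => f i b).HasFiniteMulSupport) :
    (s.map fun b => ∏ᶠ i, f i b).prod = ∏ᶠ i, (s.map (f i)).prod ∧
      (fun i => (s.map (f i)).prod).HasFiniteMulSupport := by
  induction s using Multiset.induction_on with
  | empty => simp [Function.HasFiniteMulSupport]
  | cons b s ih =>
    simp only [Multiset.map_cons, Multiset.prod_cons]
    refine ⟨?_, ?_⟩
    · rw [ih.1, finprod_mul_distrib (hf b) ih.2]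
    · exact (Set.Finite.union (hf b) ih.2).subset (Function.mulSupport_mul _ _)

/-- `m` generates the prime ideal of `ℤ` below `v`; it is the divisor that
`gaussNorm_eq_inv_of_eq_mul_C` requires. -/
theorem exists_not_isUnit_dvd (v : FinitePlace K) :
    ∃ m : ℤ, ¬ IsUnit m ∧ ∀ r : ℤ, v.1 (r : K) < 1 → m ∣ r := by
  let I : Ideal ℤ := v.maximalIdeal.asIdeal.comap (Int.castRingHom (𝓞 K))
  obtain ⟨m, hm⟩ := (IsPrincipalIdealRing.principal I).principal
  have hI : ∀ r : ℤ, r ∈ I ↔ m ∣ r := fun r => by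
    rw [hm]
    exact Ideal.mem_span_singleton
  refine ⟨m, fun hu => ?_, fun r hr => (hI r).1 ?_⟩
  · have h1 : (1 : ℤ) ∈ I := (hI 1).2 hu.dvd
    exact v.maximalIdeal.isPrime.ne_top ((Ideal.eq_top_iff_one _).2 (by simpa [I] using h1))
  · have := FinitePlace.norm_lt_one_iff_mem K v.maximalIdeal (r : 𝓞 K)
    rw [FinitePlace.norm_embedding_eq] at this
    exact this.1 (by simpa using! hr)

theorem apply_intCast_le_one (v : FinitePlace K) (r : ℤ) : v.1 (r : K) ≤ 1 := by
  have := FinitePlace.norm_le_one K v.maximalIdeal (r : 𝓞 K)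
  rw [FinitePlace.norm_embedding_eq] at this
  simpa using! this

theorem isNonarchimedean_finitePlace (v : FinitePlace K) : IsNonarchimedean v.1 :=
  fun x y => FinitePlace.add_le v x y

/-- The infinite part of the height over a number field, as a sum over the embeddings in `ℂ`. -/
theorem sum_mult_mul_eq_sum_embeddings (g : ℝ → ℝ) (x : K) :
    ∑ v : InfinitePlace K, v.mult * g (v x) = ∑ φ : K →+* ℂ, g ‖φ x‖ := by
  classical
  rw [← Finset.sum_fiberwise Finset.univ InfinitePlace.mk]
  refine Finset.sum_congr rfl fun v _ => ?_
  rw [Finset.sum_congr rfl (g := fun _ => g (v x)), Finset.sum_const,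
    InfinitePlace.card_filter_mk_eq, nsmul_eq_mul]
  intro φ hφ
  rw [← (Finset.mem_filter.1 hφ).2, InfinitePlace.apply]

theorem finiteHeight_nonneg (x : K) : 0 ≤ finiteHeight K x :=
  finprod_nonneg fun _ => le_max_of_le_right zero_le_one

theorem aeval_map_intCast {Ω : Type} [Field Ω] [Algebra ℚ Ω] {P : ℤ[X]} {α : Ω}
    (hα : aeval α P = 0) : aeval α (P.map (algebraMap ℤ ℚ)) = 0 := by
  rwa [aeval_map_algebraMap]

/-- In the splitting field `E`, the product over the finite places of the Gauss norms of the minimal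
polynomial is computed twice. Primitivity of `P` and the product formula give `|lc P|^[E:ℚ]`.
Factoring into roots gives the product of their finite heights, each the same power of that of the
generator, in total the exponent `[E:ℚ]`. -/
theorem finiteHeight_gen {Ω : Type} [Field Ω] [CharZero Ω] {P : ℤ[X]} (hP : Irreducible P)
    (hd : P.natDegree ≠ 0) {α : Ω} (hα : aeval α P = 0) (hi : IsIntegral ℚ α)
    [NumberField ℚ⟮α⟯] :
    finiteHeight ℚ⟮α⟯ (AdjoinSimple.gen ℚ α) = |(P.leadingCoeff : ℝ)| := by
  have hm := minpoly_eq_map_mul_C (K := ℚ) hP hd (aeval_map_intCast hα)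
  let E := SplittingField (minpoly ℚ α)
  have : CharZero E := charZero_of_injective_algebraMap (algebraMap ℚ E).injective
  have : NumberField E := {}
  have hsplit : ((minpoly ℚ α).map (algebraMap ℚ E)).Splits := SplittingField.splits _
  have hlc : (P.leadingCoeff : E) ≠ 0 := by
    exact_mod_cast leadingCoeff_ne_zero.2 hP.ne_zero
  have hmE : (minpoly ℚ α).map (algebraMap ℚ E) =
      P.map (Int.castRingHom E) * C (Int.castRingHom E P.leadingCoeff)⁻¹ := by
    refine (congrArg (Polynomial.map (algebraMap ℚ E)) hm).trans ?_
    rw [Polynomial.map_mul, Polynomial.map_map, Polynomial.map_C, map_inv₀]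
    congr 3
  have hprod : (minpoly ℚ α).map (algebraMap ℚ E) =
      (((minpoly ℚ α).aroots E).map fun x => X - C x).prod :=
    hsplit.eq_prod_roots_of_monic ((minpoly.monic hi).map _)
  obtain ⟨h1, -⟩ := finprod_multiset_map_prod ((minpoly ℚ α).aroots E)
    (fun (v : FinitePlace E) x => max (v x) 1) hasFiniteMulSupport_max
  have h2 : ∀ v : FinitePlace E, (((minpoly ℚ α).aroots E).map fun x => max (v x) 1).prod =
      (v (P.leadingCoeff : E))⁻¹ := by
    intro v
    obtain ⟨m, hmu, hmd⟩ := exists_not_isUnit_dvd v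
    have := gaussNorm_eq_inv_of_eq_mul_C (isNonarchimedean_finitePlace v)
      (f := Int.castRingHom E) (apply_intCast_le_one v) hmd hmu (hP.isPrimitive hd) hmE
    rw [hprod, gaussNorm_prod_X_sub_C (isNonarchimedean_finitePlace v)] at this
    refine Eq.trans ?_ this
    congr 1
    exact Multiset.map_congr rfl fun x _ => max_comm _ _
  rw [finprod_congr h2, finprod_inv_distrib, FinitePlace.prod_eq_inv_abs_norm hlc, Rat.cast_inv, inv_inv] at h1
  have hnorm : Algebra.norm ℚ (P.leadingCoeff : E) =
      (P.leadingCoeff : ℚ) ^ Module.finrank ℚ E := by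
    rw [← Algebra.norm_algebraMap]
    simp
  have hroot : ∀ β ∈ (minpoly ℚ α).aroots E, ∃ m, Module.finrank ℚ ℚ⟮α⟯ * m = Module.finrank ℚ E ∧
      finiteHeight E β = finiteHeight ℚ⟮α⟯ (AdjoinSimple.gen ℚ α) ^ m := by
    intro β hβ
    let σ : ℚ⟮α⟯ →ₐ[ℚ] E := (algHomAdjoinIntegralEquiv ℚ hi).symm ⟨β, hβ⟩
    have hσ : σ (AdjoinSimple.gen ℚ α) = β := algHomAdjoinIntegralEquiv_symm_apply_gen ℚ hi _
    let _ : Algebra ℚ⟮α⟯ E := σ.toRingHom.toAlgebra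
    refine ⟨Module.finrank ℚ⟮α⟯ E, ?_, ?_⟩
    · exact Module.finrank_mul_finrank _ _ _
    · rw [← finiteHeight_algebraMap, ← hσ]
      rfl
  have hm' : ∃ m, Module.finrank ℚ ℚ⟮α⟯ * m = Module.finrank ℚ E ∧ ∀ β ∈ (minpoly ℚ α).aroots E,
      finiteHeight E β = finiteHeight ℚ⟮α⟯ (AdjoinSimple.gen ℚ α) ^ m := by
    have hne : (minpoly ℚ α).aroots E ≠ 0 := by
      intro h0
      have hc := hsplit.natDegree_eq_card_roots
      rw [natDegree_map, show ((minpoly ℚ α).map (algebraMap ℚ E)).roots = 0 from h0] at hc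
      exact (minpoly.natDegree_pos hi).ne' hc
    obtain ⟨β, hβ⟩ := Multiset.exists_mem_of_ne_zero hne
    obtain ⟨m, hm1, -⟩ := hroot β hβ
    refine ⟨m, hm1, fun γ hγ => ?_⟩
    obtain ⟨m', hm2, h⟩ := hroot γ hγ
    rw [h, Nat.eq_of_mul_eq_mul_left Module.finrank_pos (hm2.trans hm1.symm)]
  obtain ⟨m, hm1, hm2⟩ := hm'
  have h3 : (((minpoly ℚ α).aroots E).map fun β => ∏ᶠ v : FinitePlace E, max (v β) 1).prod =
      finiteHeight ℚ⟮α⟯ (AdjoinSimple.gen ℚ α) ^ Module.finrank ℚ E := by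
    change (((minpoly ℚ α).aroots E).map (finiteHeight E)).prod = _
    rw [Multiset.map_congr rfl hm2, Multiset.map_const', Multiset.prod_replicate, ← pow_mul,
      ← hm1, adjoin.finrank hi, mul_comm m]
    congr 2
    rw [← hsplit.natDegree_eq_card_roots, natDegree_map]
  rw [h3, hnorm] at h1
  refine (pow_left_inj₀ (finiteHeight_nonneg _) (abs_nonneg _)
    (Module.finrank_pos (R := ℚ) (M := E)).ne').1 (h1.trans ?_)
  push_cast
  rw [abs_pow]

/-- The finite places contribute `log |lc P|` and the infinite ones the sum of `log⁺` over the
conjugates; Jensen's formula assembles them. -/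
theorem finrank_mul_absLogHeight₁ {Ω : Type} [Field Ω] [CharZero Ω] {P : ℤ[X]} (hP : Irreducible P)
    (hd : P.natDegree ≠ 0) {α : Ω} (hα : aeval α P = 0) :
    Module.finrank ℚ ℚ⟮α⟯ * absLogHeight₁ α = logMahler P := by
  have hi : IsIntegral ℚ α := isAlgebraic_iff_isIntegral.1
    ⟨P.map (algebraMap ℤ ℚ), (Polynomial.map_ne_zero_iff Int.cast_injective).2 hP.ne_zero,
      aeval_map_intCast hα⟩
  have hfd : FiniteDimensional ℚ ℚ⟮α⟯ := adjoin.finiteDimensional hi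
  have hnf : NumberField ℚ⟮α⟯ := {}
  have hD : (Module.finrank ℚ ℚ⟮α⟯ : ℝ) ≠ 0 := by
    exact_mod_cast Module.finrank_pos.ne'
  have h1 : Module.finrank ℚ ℚ⟮α⟯ * absLogHeight₁ α =
      Real.log (Height.mulHeight₁ (AdjoinSimple.gen ℚ α)) := by
    rw [absLogHeight₁, absMulHeight₁, dif_pos hi, Real.log_rpow (by positivity), ← mul_assoc,
      mul_inv_cancel₀ hD, one_mul]
  have hpos : ∀ v : InfinitePlace ℚ⟮α⟯, 0 < max (v (AdjoinSimple.gen ℚ α)) 1 :=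
    fun v => lt_max_of_lt_right one_pos
  have hm := minpoly_eq_map_mul_C (K := ℚ) hP hd (aeval_map_intCast hα)
  rw [h1, mulHeight₁_eq, Real.log_mul (Finset.prod_ne_zero_iff.2 fun v _ => (pow_pos (hpos v) _).ne'),
    ← finiteHeight, finiteHeight_gen hP hd hα hi, Real.log_prod]
  · simp only [Real.log_pow]
    have hsum : ∑ φ : ℚ⟮α⟯ →+* ℂ, Real.log (max ‖φ (AdjoinSimple.gen ℚ α)‖ 1) =
        (((minpoly ℚ α).aroots ℂ).map fun x => Real.log (max ‖x‖ 1)).sum := by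
      rw [← sum_embeddings_eq_sum_aroots hi]
      exact Fintype.sum_equiv (RingHom.equivRatAlgHom (R := ℚ⟮α⟯) (S := ℂ)) _ _ fun _ => rfl
    rw [sum_mult_mul_eq_sum_embeddings (fun x => Real.log (max x 1)), hsum]
    have : (minpoly ℚ α).aroots ℂ = (P.map (Int.castRingHom ℂ)).roots := by
      rw [aroots, hm, Polynomial.map_mul, Polynomial.map_C, Polynomial.map_map, mul_comm,
        roots_C_mul]
      · congr 2
      · simpa using hP.ne_zero
    rw [this, logMahler, logMahlerMeasure_eq_log_leadingCoeff_add_sum_log_roots,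
      leadingCoeff_map_of_injective (RingHom.injective_int _), add_comm]
    congr 1
    · simp
    · congr 1
      refine Multiset.map_congr rfl fun x _ => ?_
      rw [Real.posLog_eq_log_max_one (norm_nonneg _), max_comm]
  · exact fun v _ => (pow_pos (hpos v) _).ne'
  · rw [← finiteHeight, finiteHeight_gen hP hd hα hi]
    simpa using hP.ne_zero

end FiniteHeight

/-! ### Integration over the adelic curve -/

theorem integral_count_of_forall_ne_eq_zero {X : Type*} [MeasurableSpace X]
    [DiscreteMeasurableSpace X] {f : X → ℝ} {x : X} (hf : ∀ y, y ≠ x → f y = 0) :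
    Integrable f Measure.count ∧ ∫ y, f y ∂Measure.count = f x := by
  constructor
  · rw [integrable_count_iff]
    exact (hasSum_single x fun y hy => by rw [hf y hy, norm_zero]).summable
  · rw [← setIntegral_eq_integral_of_forall_compl_eq_zero (s := {x}) hf, integral_singleton]
    simp [Measure.real]

instance : DiscreteMeasurableSpace ClosedPoint := ⟨fun _ => trivial⟩

instance : DiscreteMeasurableSpace PrimeNumber := ⟨fun _ => trivial⟩

theorem measurableEmbedding_inl {X Y : Type*} [MeasurableSpace X] [MeasurableSpace Y] :
    MeasurableEmbedding (Sum.inl : X → X ⊕ Y) :=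
  ⟨Sum.inl_injective, measurable_inl, fun _ hs => measurableSet_inl_image.2 hs⟩

theorem measurableEmbedding_inr {X Y : Type*} [MeasurableSpace X] [MeasurableSpace Y] :
    MeasurableEmbedding (Sum.inr : Y → X ⊕ Y) :=
  ⟨Sum.inr_injective, measurable_inr, fun _ hs => measurableSet_inr_image.2 hs⟩

/-- The Lebesgue measure on the set of transcendental angles. -/
def angleMeasure : Measure TranscendentalAngle :=
  Measure.comap (Subtype.val : TranscendentalAngle → ℝ) volume

theorem integral_nu {f : Omega → ℝ} (h₁ : Integrable (fun x : ClosedPoint => f (.inl x)) Measure.count)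
    (h₂ : Integrable (fun p : PrimeNumber => f (.inr (.inl p))) Measure.count)
    (h₃ : Integrable (fun t : TranscendentalAngle => f (.inr (.inr t))) angleMeasure) :
    Integrable f nu ∧ ∫ ω, f ω ∂nu = ∫ x, f (.inl x) ∂Measure.count +
      ∫ p, f (.inr (.inl p)) ∂Measure.count + ∫ t, f (.inr (.inr t)) ∂angleMeasure := by
  have e₁ : MeasurableEmbedding (Sum.inl : ClosedPoint → Omega) := measurableEmbedding_inl
  have e₂ : MeasurableEmbedding (fun p : PrimeNumber => (Sum.inr (Sum.inl p) : Omega)) :=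
    measurableEmbedding_inr.comp measurableEmbedding_inl
  have e₃ : MeasurableEmbedding (fun t : TranscendentalAngle => (Sum.inr (Sum.inr t) : Omega)) :=
    measurableEmbedding_inr.comp measurableEmbedding_inr
  have i₁ := (e₁.integrable_map_iff (g := f)).2 h₁
  have i₂ := (e₂.integrable_map_iff (g := f)).2 h₂
  have i₃ := (e₃.integrable_map_iff (g := f)).2 h₃
  refine ⟨(i₁.add_measure i₂).add_measure i₃, ?_⟩
  rw [nu, ← angleMeasure, integral_add_measure (i₁.add_measure i₂) i₃, integral_add_measure i₁ i₂,
    e₁.integral_map, e₂.integral_map, e₃.integral_map]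

/-- The point of the unit circle of angle `t`. -/
def TranscendentalAngle.point (t : TranscendentalAngle) : ℂ :=
  Complex.exp (2 * Real.pi * Complex.I * (t.1 : ℂ))

/-- There are countably many algebraic numbers, and `t ↦ e^{2πit}` is injective on `(0, 1]`; the
endpoint `0` is added by hand. So the excluded angles form a null set. -/
theorem countable_algebraic_angles :
    {t : ℝ | t ∈ Set.Icc (0 : ℝ) 1 ∧
      ¬ Transcendental ℚ (Complex.exp (2 * Real.pi * Complex.I * (t : ℂ)))}.Countable := by
  have h : {t : ℝ | t ∈ Set.Ioc (0 : ℝ) 1 ∧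
      ¬ Transcendental ℚ (Complex.exp (2 * Real.pi * Complex.I * (t : ℂ)))}.Countable := by
    refine Set.countable_of_injective_of_countable_image
      (f := fun t : ℝ => Complex.exp (2 * Real.pi * Complex.I * (t : ℂ))) ?_
      ((Algebraic.countable ℚ ℂ).mono ?_)
    · rintro t ⟨⟨ht0, ht1⟩, -⟩ s ⟨⟨hs0, hs1⟩, -⟩ hts
      obtain ⟨n, hn⟩ := Complex.exp_eq_exp_iff_exists_int.1 hts
      have h2 : ((t : ℂ) - (s + n)) = 0 := by
        refine (mul_eq_zero.1 ?_).resolve_left Complex.two_pi_I_ne_zero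
        linear_combination hn
      have h3 : t = s + n := by
        have : ((t - (s + n) : ℝ) : ℂ) = 0 := by push_cast; exact h2
        exact sub_eq_zero.1 (Complex.ofReal_eq_zero.1 this)
      have h4 : (n : ℝ) < 1 := by linarith
      have h5 : (-1 : ℝ) < n := by linarith
      have : n = 0 := by
        have h4 : n < 1 := by exact_mod_cast h4
        have h5 : -1 < n := by exact_mod_cast h5
        omega
      simpa [this] using h3
    · rintro _ ⟨t, ⟨-, ht⟩, rfl⟩
      exact not_not.1 ht
  refine (h.union (Set.countable_singleton 0)).mono ?_
  rintro t ⟨⟨h0, h1⟩, ht⟩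
  rcases h0.eq_or_lt with h | h
  · exact Or.inr h.symm
  · exact Or.inl ⟨⟨h, h1⟩, ht⟩

theorem integral_angleMeasure {h : ℂ → ℝ}
    (hh : Integrable (fun θ => h (circleMap 0 1 θ)) circleMeasure) :
    Integrable (fun t : TranscendentalAngle => h t.point) angleMeasure ∧
      ∫ t : TranscendentalAngle, h t.point ∂angleMeasure = Real.circleAverage h 0 1 := by
  set S : Set ℝ := {t : ℝ | t ∈ Set.Icc (0 : ℝ) 1 ∧
    Transcendental ℚ (Complex.exp (2 * Real.pi * Complex.I * (t : ℂ)))} with hS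
  have hSdiff : S = Set.Icc 0 1 \ {t : ℝ | t ∈ Set.Icc (0 : ℝ) 1 ∧
      ¬ Transcendental ℚ (Complex.exp (2 * Real.pi * Complex.I * (t : ℂ)))} := by
    ext t
    simp only [hS, Set.mem_sdiff, Set.mem_ofPred_eq]
    tauto
  have hmeas : MeasurableSet S := by
    rw [hSdiff]
    exact measurableSet_Icc.diff countable_algebraic_angles.measurableSet
  have hae : S =ᵐ[volume] Set.Ioc (0 : ℝ) 1 := by
    rw [hSdiff]
    exact (sdiff_null_ae_eq_self (countable_algebraic_angles.measure_zero _)).trans Ioc_ae_eq_Icc.symm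
  have hcm : ∀ t : ℝ, circleMap 0 1 (2 * Real.pi * t) =
      Complex.exp (2 * Real.pi * Complex.I * (t : ℂ)) := by
    intro t
    rw [circleMap, zero_add, Complex.ofReal_one, one_mul]
    congr 1
    push_cast
    ring
  set g : ℝ → ℝ := fun t => h (Complex.exp (2 * Real.pi * Complex.I * (t : ℂ))) with hg
  have hI : IntervalIntegrable (fun θ => h (circleMap 0 1 θ)) volume 0 (2 * Real.pi) :=
    (intervalIntegrable_iff_integrableOn_Ioc_of_le Real.two_pi_pos.le).2 hh
  have hI2 := hI.comp_mul_left (c := 2 * Real.pi)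
  have hpi : (2 * Real.pi) ≠ 0 := Real.two_pi_pos.ne'
  rw [zero_div, div_self hpi, intervalIntegrable_iff_integrableOn_Ioc_of_le zero_le_one] at hI2
  simp only [hcm] at hI2
  constructor
  · have : IntegrableOn g S := hI2.congr_set_ae hae
    rw [IntegrableOn, ← map_comap_subtype_coe hmeas,
      (MeasurableEmbedding.subtype_coe hmeas).integrable_map_iff] at this
    exact this
  · refine (integral_subtype_comap hmeas g).trans ?_
    rw [setIntegral_congr_set hae, ← intervalIntegral.integral_of_le zero_le_one,
      Real.circleAverage_def]
    simp only [hg, ← hcm]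
    rw [intervalIntegral.integral_comp_mul_left (fun θ => h (circleMap 0 1 θ)) hpi, mul_zero, mul_one]

/-! ### The field `ℚ(T)` as the fraction field of `ℤ[T]` -/

/-- The embedding of `ℤ[T]` in `ℚ(T)`. -/
def ratFuncOfInt : ℤ[X] →+* RatFunc ℚ :=
  (algebraMap ℚ[X] (RatFunc ℚ)).comp (mapRingHom (Int.castRingHom ℚ))

theorem ratFuncOfInt_apply (r : ℤ[X]) :
    ratFuncOfInt r = algebraMap ℚ[X] (RatFunc ℚ) (r.map (Int.castRingHom ℚ)) := rfl

theorem ratFuncOfInt_injective : Function.Injective ratFuncOfInt :=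
  (RatFunc.algebraMap_injective ℚ).comp (map_injective _ Int.cast_injective)

instance : Algebra ℤ[X] (RatFunc ℚ) := ratFuncOfInt.toAlgebra

theorem algebraMap_eq_ratFuncOfInt : algebraMap ℤ[X] (RatFunc ℚ) = ratFuncOfInt := rfl

instance : FaithfulSMul ℤ[X] (RatFunc ℚ) :=
  (faithfulSMul_iff_algebraMap_injective _ _).2 ratFuncOfInt_injective

theorem exists_intCast_mul_eq_map (f : ℚ[X]) :
    ∃ (b : ℤ) (g : ℤ[X]), b ≠ 0 ∧ g.map (Int.castRingHom ℚ) = C (b : ℚ) * f := by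
  obtain ⟨b, hb, hbf⟩ := IsLocalization.integerNormalization_spec (nonZeroDivisors ℤ) f
  refine ⟨b, IsLocalization.integerNormalization (nonZeroDivisors ℤ) f,
    nonZeroDivisors.ne_zero hb, ?_⟩
  ext i
  have h := congrArg (fun P : ℚ[X] => P.coeff i) hbf
  simpa using h

instance : IsFractionRing ℤ[X] (RatFunc ℚ) := by
  refine IsFractionRing.of_field _ _ fun z => ?_
  obtain ⟨b, g, hb, hg⟩ := exists_intCast_mul_eq_map z.num
  obtain ⟨b', g', hb', hg'⟩ := exists_intCast_mul_eq_map z.denom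
  refine ⟨C b' * g, C b * g', ?_⟩
  have hbQ : (C (b : ℚ) : ℚ[X]) ≠ 0 := C_ne_zero.2 (by exact_mod_cast hb)
  have hbQ' : (C (b' : ℚ) : ℚ[X]) ≠ 0 := C_ne_zero.2 (by exact_mod_cast hb')
  rw [algebraMap_eq_ratFuncOfInt, ratFuncOfInt_apply, ratFuncOfInt_apply, Polynomial.map_mul,
    Polynomial.map_mul, hg, hg', map_C, map_C, eq_intCast, eq_intCast]
  conv_lhs => rw [← RatFunc.num_div_denom z]
  rw [show (C (b' : ℚ) : ℚ[X]) * (C (b : ℚ) * z.num) = (C (b' : ℚ) * C (b : ℚ)) * z.num by ring,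
    show (C (b : ℚ) : ℚ[X]) * (C (b' : ℚ) * z.denom) = (C (b' : ℚ) * C (b : ℚ)) * z.denom by ring,
    map_mul _ _ z.num, map_mul _ _ z.denom, mul_div_mul_left]
  exact RatFunc.algebraMap_ne_zero (mul_ne_zero hbQ' hbQ)

/-! ### The places of the closed points -/

theorem ClosedPoint.irreducible_intPoly (x : ClosedPoint) : Irreducible x.intPoly :=
  x.exists_intPoly.choose_spec.1

theorem ClosedPoint.span_intPoly (x : ClosedPoint) :
    Ideal.span {x.intPoly.map (Int.castRingHom ℚ)} = x.asIdeal :=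
  x.exists_intPoly.choose_spec.2

theorem ClosedPoint.natDegree_intPoly_ne_zero (x : ClosedPoint) : x.intPoly.natDegree ≠ 0 := by
  intro h
  apply x.isPrime.ne_top
  rw [← x.span_intPoly, Ideal.span_singleton_eq_top, eq_C_of_natDegree_eq_zero h, map_C, isUnit_C,
    isUnit_iff_ne_zero]
  intro h0
  apply x.irreducible_intPoly.ne_zero
  rw [eq_C_of_natDegree_eq_zero h]
  simpa using h0

theorem ClosedPoint.isPrimitive_intPoly (x : ClosedPoint) : x.intPoly.IsPrimitive :=
  x.irreducible_intPoly.isPrimitive x.natDegree_intPoly_ne_zero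

theorem ClosedPoint.map_mem_asIdeal_iff (x : ClosedPoint) (r : ℤ[X]) :
    r.map (Int.castRingHom ℚ) ∈ x.asIdeal ↔ x.intPoly ∣ r := by
  rw [← x.span_intPoly, Ideal.mem_span_singleton]
  exact (IsPrimitive.Int.dvd_iff_map_cast_dvd_map_cast _ _ x.isPrimitive_intPoly).symm

theorem ClosedPoint.absVal_apply (x : ClosedPoint) {φ : RatFunc ℚ} (hφ : φ ≠ 0) :
    x.absVal φ = x.H ^ WithZero.log (IsDedekindDomain.HeightOneSpectrum.valuation (RatFunc ℚ) x φ) := by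
  refine (if_neg hφ).trans ?_
  rw [ClosedPoint.ord, neg_neg]

theorem ClosedPoint.isNonarchimedean_absVal (x : ClosedPoint) : IsNonarchimedean x.absVal := by
  intro φ ψ
  by_cases h1 : φ = 0
  · simp [h1]
  by_cases h2 : ψ = 0
  · simp [h2]
  by_cases h3 : φ + ψ = 0
  · simp [h3]
  rw [x.absVal_apply h1, x.absVal_apply h2, x.absVal_apply h3, le_max_iff]
  have v3 := (Valuation.ne_zero_iff
    (IsDedekindDomain.HeightOneSpectrum.valuation (RatFunc ℚ) x)).2 h3
  refine (le_max_iff.1 (Valuation.map_add (IsDedekindDomain.HeightOneSpectrum.valuation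
    (RatFunc ℚ) x) φ ψ)).imp (fun h => ?_) fun h => ?_
  · exact zpow_le_zpow_right₀ x.one_le_H
      ((WithZero.log_le_log v3 ((Valuation.ne_zero_iff _).2 h1)).2 h)
  · exact zpow_le_zpow_right₀ x.one_le_H
      ((WithZero.log_le_log v3 ((Valuation.ne_zero_iff _).2 h2)).2 h)

theorem ClosedPoint.absVal_ratFuncOfInt_le_one (x : ClosedPoint) (r : ℤ[X]) :
    x.absVal (ratFuncOfInt r) ≤ 1 := by
  by_cases hr : ratFuncOfInt r = 0
  · simp [hr]
  rw [x.absVal_apply hr, ← zpow_zero x.H]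
  refine zpow_le_zpow_right₀ x.one_le_H ?_
  rw [← WithZero.log_one]
  refine (WithZero.log_le_log ((Valuation.ne_zero_iff _).2 hr) one_ne_zero).2 ?_
  exact IsDedekindDomain.HeightOneSpectrum.valuation_le_one _ _

theorem ClosedPoint.valuation_eq_one (x : ClosedPoint) {r : ℤ[X]} (hr : ¬ x.intPoly ∣ r) :
    IsDedekindDomain.HeightOneSpectrum.valuation (RatFunc ℚ) x (ratFuncOfInt r) = 1 := by
  refine le_antisymm (IsDedekindDomain.HeightOneSpectrum.valuation_le_one _ _) (not_lt.1 fun h => hr ?_)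
  exact (x.map_mem_asIdeal_iff r).1
    ((IsDedekindDomain.HeightOneSpectrum.valuation_lt_one_iff_mem _ _).1 h)

theorem ClosedPoint.absVal_eq_one (x : ClosedPoint) {r : ℤ[X]} (hr : ¬ x.intPoly ∣ r) :
    x.absVal (ratFuncOfInt r) = 1 := by
  have h0 : ratFuncOfInt r ≠ 0 := by
    rw [Ne, map_eq_zero_iff _ ratFuncOfInt_injective]
    rintro rfl
    exact hr (dvd_zero _)
  rw [x.absVal_apply h0, x.valuation_eq_one hr, WithZero.log_one, zpow_zero]

theorem ClosedPoint.absVal_intPoly (x : ClosedPoint) :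
    x.absVal (ratFuncOfInt x.intPoly) = x.H⁻¹ := by
  have h0 : ratFuncOfInt x.intPoly ≠ 0 := by
    rw [Ne, map_eq_zero_iff _ ratFuncOfInt_injective]
    exact x.irreducible_intPoly.ne_zero
  have hm0 : x.intPoly.map (Int.castRingHom ℚ) ≠ 0 :=
    (Polynomial.map_ne_zero_iff Int.cast_injective).2 x.irreducible_intPoly.ne_zero
  have hv : IsDedekindDomain.HeightOneSpectrum.valuation (RatFunc ℚ) x (ratFuncOfInt x.intPoly) =
      WithZero.exp (-1) :=
    (IsDedekindDomain.HeightOneSpectrum.valuation_of_algebraMap (K := RatFunc ℚ) _ _).trans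
      (IsDedekindDomain.HeightOneSpectrum.intValuation_singleton _ hm0 x.span_intPoly.symm)
  rw [x.absVal_apply h0, hv, WithZero.log_exp, zpow_neg_one]

/-! ### The places of the prime numbers -/

theorem PrimeNumber.isNonarchimedean_padic (p : PrimeNumber) [Fact p.1.Prime] :
    IsNonarchimedean (Rat.AbsoluteValue.padic p.1) := fun a b => by
  have h := padicNorm.nonarchimedean (p := p.1) (q := a) (r := b)
  simp only [Rat.AbsoluteValue.padic_eq_padicNorm]
  exact_mod_cast h

theorem extendAbs_algebraMap (g : AbsoluteValue ℚ[X] ℝ) (f : ℚ[X]) :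
    extendAbs g (algebraMap ℚ[X] (RatFunc ℚ) f) = g f := by
  have := extendAbs_aux g (φ := algebraMap ℚ[X] (RatFunc ℚ) f) (p := f) (q := 1) one_ne_zero
    (by simp)
  rw [map_one, div_one] at this
  exact this

theorem PrimeNumber.isNonarchimedean_absVal (p : PrimeNumber) : IsNonarchimedean p.absVal := by
  have : Fact p.1.Prime := ⟨p.2⟩
  intro φ ψ
  obtain ⟨a, b, hb, rfl⟩ := IsFractionRing.div_surjective ℚ[X] φ
  obtain ⟨c, d, hd, rfl⟩ := IsFractionRing.div_surjective ℚ[X] ψ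
  have hb := nonZeroDivisors.ne_zero hb
  have hd := nonZeroDivisors.ne_zero hd
  have eb := RatFunc.algebraMap_ne_zero hb
  have ed := RatFunc.algebraMap_ne_zero hd
  have h : ∀ f : ℚ[X], p.absVal (algebraMap ℚ[X] (RatFunc ℚ) f) = p.polyAbsVal f :=
    extendAbs_algebraMap _
  have pb := p.polyAbsVal.pos hb
  have pd := p.polyAbsVal.pos hd
  have key : p.polyAbsVal (a * d + b * c) ≤ max (p.polyAbsVal (a * d)) (p.polyAbsVal (b * c)) :=
    isNonarchimedean_gaussNorm _ p.isNonarchimedean_padic zero_le_one _ _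
  rw [div_add_div _ _ eb ed, ← map_mul, ← map_mul, ← map_mul, ← map_add, map_div₀, map_div₀,
    map_div₀, h, h, h, h, h, h, map_mul p.polyAbsVal b d, div_le_iff₀ (by positivity),
    max_mul_of_nonneg _ _ (by positivity)]
  refine key.trans (le_of_eq ?_)
  rw [map_mul, map_mul]
  congr 1
  · field_simp
  · field_simp

theorem PrimeNumber.absVal_ratFuncOfInt (p : PrimeNumber) [Fact p.1.Prime] (r : ℤ[X]) :
    p.absVal (ratFuncOfInt r) =
      (r.map (Int.castRingHom ℚ)).gaussNorm (Rat.AbsoluteValue.padic p.1) 1 :=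
  extendAbs_algebraMap _ _

theorem padic_intCast_le_one (p : ℕ) [Fact p.Prime] (n : ℤ) :
    Rat.AbsoluteValue.padic p (n : ℚ) ≤ 1 := by
  rw [Rat.AbsoluteValue.padic_eq_padicNorm]
  exact_mod_cast padicNorm.of_int n

theorem dvd_of_padic_lt_one {p : ℕ} [Fact p.Prime] {n : ℤ}
    (h : Rat.AbsoluteValue.padic p (n : ℚ) < 1) : (p : ℤ) ∣ n := by
  rw [Rat.AbsoluteValue.padic_eq_padicNorm] at h
  exact (padicNorm.int_lt_one_iff n).1 (by exact_mod_cast h)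

theorem PrimeNumber.absVal_ratFuncOfInt_le_one (p : PrimeNumber) (r : ℤ[X]) :
    p.absVal (ratFuncOfInt r) ≤ 1 := by
  have : Fact p.1.Prime := ⟨p.2⟩
  rw [p.absVal_ratFuncOfInt]
  obtain ⟨i, hi⟩ := exists_eq_gaussNorm (Rat.AbsoluteValue.padic p.1) 1
    (r.map (Int.castRingHom ℚ))
  rw [hi, coeff_map, one_pow, mul_one]
  exact padic_intCast_le_one _ _

theorem PrimeNumber.dvd_of_absVal_lt_one (p : PrimeNumber) {r : ℤ[X]}
    (h : p.absVal (ratFuncOfInt r) < 1) : C (p.1 : ℤ) ∣ r := by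
  have : Fact p.1.Prime := ⟨p.2⟩
  refine (C_dvd_iff_dvd_coeff _ _).2 fun i => dvd_of_padic_lt_one (p := p.1) ?_
  have := le_gaussNorm (Rat.AbsoluteValue.padic p.1) (r.map (Int.castRingHom ℚ))
    (zero_le_one (α := ℝ)) i
  rw [one_pow, mul_one, coeff_map] at this
  exact this.trans_lt (p.absVal_ratFuncOfInt r ▸ h)

theorem PrimeNumber.not_isUnit_C (p : PrimeNumber) : ¬ IsUnit (C (p.1 : ℤ)) := by
  rw [isUnit_C]
  exact (Nat.prime_iff_prime_int.1 p.2).not_isUnit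

theorem PrimeNumber.absVal_eq_one (p : PrimeNumber) {r : ℤ[X]} (h : ¬ C (p.1 : ℤ) ∣ r) :
    p.absVal (ratFuncOfInt r) = 1 :=
  le_antisymm (p.absVal_ratFuncOfInt_le_one r) (not_lt.1 fun h' => h (p.dvd_of_absVal_lt_one h'))

theorem PrimeNumber.absVal_self (p : PrimeNumber) :
    p.absVal (ratFuncOfInt (C (p.1 : ℤ))) = (p.1 : ℝ)⁻¹ := by
  have : Fact p.1.Prime := ⟨p.2⟩
  rw [p.absVal_ratFuncOfInt, map_C, gaussNorm_C, Rat.AbsoluteValue.padic_eq_padicNorm]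
  simp

/-! ### The archimedean places -/

theorem TranscendentalAngle.evalHom_algebraMap (t : TranscendentalAngle) (f : ℚ[X]) :
    t.evalHom (algebraMap ℚ[X] (RatFunc ℚ) f) = aeval t.point f :=
  RatFunc.liftRingHom_algebraMap _ _ _

theorem TranscendentalAngle.evalHom_ratFuncOfInt (t : TranscendentalAngle) (r : ℤ[X]) :
    t.evalHom (ratFuncOfInt r) = aeval t.point r := by
  rw [ratFuncOfInt_apply, t.evalHom_algebraMap]
  exact aeval_map_algebraMap ℚ t.point r

theorem TranscendentalAngle.norm_point (t : TranscendentalAngle) : ‖t.point‖ = 1 := by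
  rw [TranscendentalAngle.point, show 2 * (Real.pi : ℂ) * Complex.I * (t.1 : ℂ) =
    ((2 * Real.pi * t.1 : ℝ) : ℂ) * Complex.I by push_cast; ring, Complex.norm_exp_ofReal_mul_I]

/-- A closed subfield of `ℂ` is `ℝ` or `ℂ`. A real point of the unit circle is `±1`, which is
algebraic, so `ℝ` is excluded and the completion at `t` is `ℂ`. -/
theorem TranscendentalAngle.denseRange_evalHom (t : TranscendentalAngle) : DenseRange t.evalHom := by
  have hX : t.evalHom (algebraMap ℚ[X] (RatFunc ℚ) X) = t.point := by
    rw [t.evalHom_algebraMap, aeval_X]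
  have hcl : IsClosed (t.evalHom.fieldRange.topologicalClosure : Set ℂ) :=
    t.evalHom.fieldRange.isClosed_topologicalClosure
  have hmem : t.point ∈ t.evalHom.fieldRange.topologicalClosure :=
    t.evalHom.fieldRange.le_topologicalClosure ⟨_, hX⟩
  rcases Complex.subfield_eq_of_closed hcl with h | h
  · exfalso
    rw [h] at hmem
    obtain ⟨y, hy⟩ := hmem
    have hy' : ((y : ℝ) : ℂ) = t.point := hy
    have hn := t.norm_point
    rw [← hy', Complex.norm_real, Real.norm_eq_abs] at hn
    have htr : Transcendental ℚ t.point := t.2.2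
    rw [← hy'] at htr
    rcases eq_or_eq_neg_of_abs_eq hn with h1 | h1
    · exact htr (by rw [h1]; simpa using isAlgebraic_one)
    · exact htr (by rw [h1]; simpa using isAlgebraic_one.neg)
  · intro z
    have : z ∈ closure (t.evalHom.fieldRange : Set ℂ) := by
      change z ∈ t.evalHom.fieldRange.topologicalClosure
      rw [h]
      trivial
    rwa [RingHom.coe_fieldRange] at this

theorem TranscendentalAngle.absVal_apply (t : TranscendentalAngle) (φ : RatFunc ℚ) :
    t.absVal φ = ‖t.evalHom φ‖ := rfl

/-! ### The product formula -/

theorem absVal_ratFuncOfInt_of_isUnit (v : AbsoluteValue (RatFunc ℚ) ℝ) {u : ℤ[X]} (hu : IsUnit u) :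
    v (ratFuncOfInt u) = 1 := by
  obtain ⟨r, hr, rfl⟩ := Polynomial.isUnit_iff.1 hu
  rcases Int.isUnit_iff.1 hr with rfl | rfl <;> simp

theorem logMahler_of_isUnit {u : ℤ[X]} (hu : IsUnit u) : logMahler u = 0 := by
  obtain ⟨r, hr, rfl⟩ := Polynomial.isUnit_iff.1 hu
  rcases Int.isUnit_iff.1 hr with rfl | rfl <;>
    rw [logMahler, map_C, logMahlerMeasure_const] <;> simp

theorem logMahler_eq_of_associated {q r : ℤ[X]} (hq : q ≠ 0) (h : Associated q r) :
    logMahler q = logMahler r := by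
  obtain ⟨u, rfl⟩ := h
  rw [logMahler_mul hq u.ne_zero, logMahler_of_isUnit u.isUnit, add_zero]

theorem absVal_eq_of_associated (v : AbsoluteValue (RatFunc ℚ) ℝ) {q r : ℤ[X]} (h : Associated q r) :
    v (ratFuncOfInt q) = v (ratFuncOfInt r) := by
  obtain ⟨u, rfl⟩ := h
  rw [map_mul, map_mul, absVal_ratFuncOfInt_of_isUnit v u.isUnit, mul_one]

theorem integral_log_absVal_angle {a : ℤ[X]} (ha : a ≠ 0) :
    Integrable (fun t : TranscendentalAngle => Real.log (t.absVal (ratFuncOfInt a))) angleMeasure ∧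
      ∫ t : TranscendentalAngle, Real.log (t.absVal (ratFuncOfInt a)) ∂angleMeasure =
        logMahler a := by
  have hs : ∀ x, (specialize (C a) x).logMahlerMeasure = Real.log ‖aeval x a‖ := fun x => by
    rw [specialize, map_C, logMahlerMeasure_const]
    rfl
  have h1 := integrable_logMahlerMeasure_specialize (C_ne_zero.2 ha)
  simp only [hs] at h1
  have h2 := integral_angleMeasure (h := fun x => Real.log ‖aeval x a‖) h1
  simp only [TranscendentalAngle.absVal_apply, TranscendentalAngle.evalHom_ratFuncOfInt]
  refine ⟨h2.1, h2.2.trans ?_⟩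
  rw [logMahler, logMahlerMeasure_def]
  congr 1
  funext x
  rw [eval_map, ← algebraMap_int_eq, ← aeval_def]

/-- At most one non-archimedean place contributes: the prime number for constant `q`, the closed
point where `q` vanishes otherwise. Its absolute value is normalised so as to cancel the archimedean
integral `logMahler q`. -/
theorem integral_log_absVal_of_prime {q : ℤ[X]} (hq : Prime q) :
    Integrable (fun ω => Real.log (absVal ω (ratFuncOfInt q))) nu ∧
      ∫ ω, Real.log (absVal ω (ratFuncOfInt q)) ∂nu = 0 := by
  have harch := integral_log_absVal_angle hq.ne_zero
  have hirr := hq.irreducible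
  by_cases hd : q.natDegree = 0
  · obtain ⟨n, rfl⟩ : ∃ n, q = C n := ⟨_, eq_C_of_natDegree_eq_zero hd⟩
    have hn : Prime n := prime_C_iff.1 hq
    let p : PrimeNumber := ⟨n.natAbs, Int.prime_iff_natAbs_prime.1 hn⟩
    have hassoc : Associated (C n) (C (p.1 : ℤ)) :=
      (Int.associated_natAbs n).map C
    have hx : ∀ x : ClosedPoint, Real.log (x.absVal (ratFuncOfInt (C n))) = 0 := fun x => by
      rw [x.absVal_eq_one, Real.log_one]
      intro h
      have := natDegree_le_of_dvd h hq.ne_zero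
      rw [natDegree_C] at this
      exact x.natDegree_intPoly_ne_zero (Nat.le_zero.1 this)
    have hp : ∀ p' : PrimeNumber, p' ≠ p → Real.log (p'.absVal (ratFuncOfInt (C n))) = 0 := by
      intro p' hp'
      rw [p'.absVal_eq_one, Real.log_one]
      intro h
      refine hp' (Subtype.ext ?_)
      have h1 : (p'.1 : ℤ) ∣ n := by simpa using (C_dvd_iff_dvd_coeff _ _).1 h 0
      have h2 : p'.1 ∣ p.1 := Int.natCast_dvd.1 h1
      exact (Nat.prime_dvd_prime_iff_eq p'.2 p.2).1 h2
    have hpc := integral_count_of_forall_ne_eq_zero hp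
    have hxi : Integrable (fun x : ClosedPoint => Real.log (absVal (.inl x) (ratFuncOfInt (C n))))
        Measure.count := by
      change Integrable (fun x : ClosedPoint => Real.log (x.absVal (ratFuncOfInt (C n)))) _
      simp only [hx]
      exact integrable_zero _ _ _
    obtain ⟨i, e⟩ := integral_nu (f := fun ω => Real.log (absVal ω (ratFuncOfInt (C n))))
      hxi hpc.1 harch.1
    refine ⟨i, e.trans ?_⟩
    change ∫ x : ClosedPoint, Real.log (x.absVal (ratFuncOfInt (C n))) ∂_ +
      ∫ p : PrimeNumber, Real.log (p.absVal (ratFuncOfInt (C n))) ∂_ +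
      ∫ t : TranscendentalAngle, Real.log (t.absVal (ratFuncOfInt (C n))) ∂_ = 0
    simp only [hx]
    rw [hpc.2, harch.2, integral_zero, absVal_eq_of_associated _ hassoc, p.absVal_self, logMahler,
      map_C, logMahlerMeasure_const, Real.log_inv]
    simp [p]
  · have hprim := hirr.isPrimitive hd
    have hqQ : Prime (q.map (Int.castRingHom ℚ)) :=
      ((IsPrimitive.Int.irreducible_iff_irreducible_map_cast hprim).1 hirr).prime
    let x : ClosedPoint := IsDedekindDomain.HeightOneSpectrum.mk
      (Ideal.span {q.map (Int.castRingHom ℚ)})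
      ((Ideal.span_singleton_prime hqQ.ne_zero).2 hqQ)
      (by rw [Ne, Ideal.span_singleton_eq_bot]; exact hqQ.ne_zero)
    have hassoc_of_dvd : ∀ x' : ClosedPoint, x'.intPoly ∣ q → Associated x'.intPoly q :=
      fun x' h => x'.irreducible_intPoly.associated_of_dvd hirr h
    have hxq : Associated x.intPoly q := hassoc_of_dvd x ((x.map_mem_asIdeal_iff q).1
      (Ideal.mem_span_singleton_self _))
    have hx : ∀ x' : ClosedPoint, x' ≠ x → Real.log (x'.absVal (ratFuncOfInt q)) = 0 := by
      intro x' hx'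
      rw [x'.absVal_eq_one, Real.log_one]
      intro h
      refine hx' (IsDedekindDomain.HeightOneSpectrum.ext ?_)
      rw [← x'.span_intPoly]
      exact Ideal.span_singleton_eq_span_singleton.2
        ((hassoc_of_dvd x' h).map (mapRingHom (Int.castRingHom ℚ)))
    have hp : ∀ p : PrimeNumber, Real.log (p.absVal (ratFuncOfInt q)) = 0 := by
      intro p
      rw [p.absVal_eq_one, Real.log_one]
      intro h
      exact p.not_isUnit_C (isUnit_C.2 (hprim _ h))
    have hxc := integral_count_of_forall_ne_eq_zero hx
    have hpi : Integrable (fun p : PrimeNumber => Real.log (absVal (.inr (.inl p)) (ratFuncOfInt q)))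
        Measure.count := by
      change Integrable (fun p : PrimeNumber => Real.log (p.absVal (ratFuncOfInt q))) _
      simp only [hp]
      exact integrable_zero _ _ _
    obtain ⟨i, e⟩ := integral_nu (f := fun ω => Real.log (absVal ω (ratFuncOfInt q)))
      hxc.1 hpi harch.1
    refine ⟨i, e.trans ?_⟩
    change ∫ x : ClosedPoint, Real.log (x.absVal (ratFuncOfInt q)) ∂_ +
      ∫ p : PrimeNumber, Real.log (p.absVal (ratFuncOfInt q)) ∂_ +
      ∫ t : TranscendentalAngle, Real.log (t.absVal (ratFuncOfInt q)) ∂_ = 0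
    simp only [hp]
    rw [hxc.2, harch.2, integral_zero, ← absVal_eq_of_associated _ hxq, x.absVal_intPoly,
      ← logMahler_eq_of_associated x.irreducible_intPoly.ne_zero hxq, Real.log_inv,
      ClosedPoint.H, ← logMahlerMeasure_eq_log_MahlerMeasure, logMahler]
    ring

/-- The product formula. -/
theorem integral_log_absVal {a : ℤ[X]} (ha : a ≠ 0) :
    Integrable (fun ω => Real.log (absVal ω (ratFuncOfInt a))) nu ∧
      ∫ ω, Real.log (absVal ω (ratFuncOfInt a)) ∂nu = 0 := by
  induction a using UniqueFactorizationMonoid.induction_on_prime with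
  | h₁ => exact absurd rfl ha
  | h₂ u hu => simp [absVal_ratFuncOfInt_of_isUnit _ hu]
  | h₃ a q ha' hq ih =>
    have hlog : ∀ ω, Real.log (absVal ω (ratFuncOfInt (q * a))) =
        Real.log (absVal ω (ratFuncOfInt q)) + Real.log (absVal ω (ratFuncOfInt a)) := by
      intro ω
      rw [map_mul, map_mul, Real.log_mul]
      · rw [Ne, AbsoluteValue.eq_zero, map_eq_zero_iff _ ratFuncOfInt_injective]
        exact hq.ne_zero
      · rw [Ne, AbsoluteValue.eq_zero, map_eq_zero_iff _ ratFuncOfInt_injective]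
        exact ha'
    obtain ⟨i₁, e₁⟩ := integral_log_absVal_of_prime hq
    obtain ⟨i₂, e₂⟩ := ih ha'
    simp only [hlog]
    exact ⟨i₁.add i₂, by rw [integral_add i₁ i₂, e₁, e₂, add_zero]⟩

/-! ### The height of an algebraic function -/

/-- The archimedean contribution to the height. -/
def archHeight (P : ℤ[X][X]) : Omega → ℝ
  | .inl _ => 0
  | .inr (.inl _) => 0
  | .inr (.inr t) => (specialize P t.point).logMahlerMeasure

theorem integral_archHeight {P : ℤ[X][X]} (hP : P ≠ 0) :
    Integrable (archHeight P) nu ∧ ∫ ω, archHeight P ω ∂nu = logMahler₂ P := by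
  obtain ⟨h1, h2⟩ := integral_angleMeasure (h := fun x => (specialize P x).logMahlerMeasure)
    (integrable_logMahlerMeasure_specialize hP)
  obtain ⟨i, e⟩ := integral_nu (f := archHeight P) (integrable_zero _ _ _) (integrable_zero _ _ _) h1
  refine ⟨i, e.trans ?_⟩
  change ∫ _, 0 ∂_ + ∫ _, 0 ∂_ + ∫ t : TranscendentalAngle, (specialize P t.point).logMahlerMeasure ∂_ = _
  rw [integral_zero, integral_zero, h2, zero_add, zero_add, logMahler₂]

theorem specialize_ne_zero {P : ℤ[X][X]} (hP : P ≠ 0) (t : TranscendentalAngle) :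
    specialize P t.point ≠ 0 := by
  intro h
  have h1 : aeval t.point P.leadingCoeff = 0 := by
    have := congrArg (fun p => p.coeff P.natDegree) h
    simpa [specialize_coeff] using this
  have h2 := (map_eq_zero t.evalHom).1 ((t.evalHom_ratFuncOfInt _).trans h1)
  exact hP (leadingCoeff_eq_zero.1 ((map_eq_zero_iff _ ratFuncOfInt_injective).1 h2))

/-- The leading coefficient enters in the same way at all places: by Gauss's lemma at the
non-archimedean ones, by Jensen's formula at the others. Written so, it is ready for the product
formula. -/
theorem fiberAverage_log_max {P : ℤ[X][X]} (hP : Irreducible P) (hd : P.natDegree ≠ 0) {Ω : Type}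
    [Field Ω] [Algebra (RatFunc ℚ) Ω] {α : Ω} (hα : aeval α (P.map ratFuncOfInt) = 0) (ω : Omega) :
    fiberAverage (absVal ω) (fun w : AbsoluteValue (RatFunc ℚ)⟮α⟯ ℝ =>
        Real.log (max 1 (w (AdjoinSimple.gen (RatFunc ℚ) α)))) =
      (Module.finrank (RatFunc ℚ) (RatFunc ℚ)⟮α⟯ : ℝ)⁻¹ *
        (archHeight P ω - Real.log (absVal ω (ratFuncOfInt P.leadingCoeff))) := by
  have hlc : ratFuncOfInt P.leadingCoeff ≠ 0 := by
    rw [Ne, map_eq_zero_iff _ ratFuncOfInt_injective]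
    exact leadingCoeff_ne_zero.2 hP.ne_zero
  have hα0 : P.map ratFuncOfInt ≠ 0 :=
    (Polynomial.map_ne_zero_iff ratFuncOfInt_injective).2 hP.ne_zero
  have hi : IsIntegral (RatFunc ℚ) α := isAlgebraic_iff_isIntegral.1 ⟨_, hα0, hα⟩
  have hprim := hP.isPrimitive hd
  let _ : NormalizedGCDMonoid ℤ[X] := Classical.choice inferInstance
  have hm : minpoly (RatFunc ℚ) α = P.map ratFuncOfInt * C (ratFuncOfInt P.leadingCoeff)⁻¹ :=
    minpoly_eq_map_mul_C (K := RatFunc ℚ) hP hd hα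
  rw [adjoin.finrank hi]
  match ω with
  | .inl x =>
    have hna : IsNonarchimedean (absVal (.inl x)) := x.isNonarchimedean_absVal
    rw [fiberAverage_of_isNonarchimedean hna hi, gaussNorm_eq_inv_of_eq_mul_C hna
      x.absVal_ratFuncOfInt_le_one (m := x.intPoly)
      (fun r hr => not_not.1 fun h => hr.ne (x.absVal_eq_one h))
      x.irreducible_intPoly.not_isUnit hprim hm, Real.log_inv, archHeight, zero_sub]
  | .inr (.inl p) =>
    have hna : IsNonarchimedean (absVal (.inr (.inl p))) := p.isNonarchimedean_absVal
    rw [fiberAverage_of_isNonarchimedean hna hi, gaussNorm_eq_inv_of_eq_mul_C hna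
      p.absVal_ratFuncOfInt_le_one (m := C (p.1 : ℤ))
      (fun r hr => p.dvd_of_absVal_lt_one hr) p.not_isUnit_C hprim hm, Real.log_inv, archHeight,
      zero_sub]
  | .inr (.inr t) =>
    rw [fiberAverage_of_complex t.evalHom t.denseRange_evalHom (fun _ => rfl) hi, hm]
    have hs : (P.map ratFuncOfInt).map t.evalHom = specialize P t.point := by
      rw [Polynomial.map_map, specialize]
      congr 1
      exact RingHom.ext fun r => t.evalHom_ratFuncOfInt r
    have h0 : t.evalHom (ratFuncOfInt P.leadingCoeff)⁻¹ ≠ 0 :=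
      (map_ne_zero t.evalHom).2 (inv_ne_zero hlc)
    rw [Polynomial.map_mul, map_C, hs, mul_comm (specialize _ _),
      logMahlerMeasure_C_mul h0 (specialize_ne_zero hP.ne_zero t), map_inv₀ t.evalHom, norm_inv, Real.log_inv,
      archHeight, neg_add_eq_sub]
    rfl

/-- The height of an algebraic function, in terms of its minimal polynomial over `ℤ[T]`. -/
theorem finrank_mul_height {P : ℤ[X][X]} (hP : Irreducible P) (hd : P.natDegree ≠ 0)
    {α : AlgebraicClosure (RatFunc ℚ)} (hα : aeval α (P.map ratFuncOfInt) = 0) :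
    Module.finrank (RatFunc ℚ) (RatFunc ℚ)⟮α⟯ = P.natDegree ∧
      Module.finrank (RatFunc ℚ) (RatFunc ℚ)⟮α⟯ * height α = logMahler₂ P := by
  have hlc : P.leadingCoeff ≠ 0 := leadingCoeff_ne_zero.2 hP.ne_zero
  have hα0 : P.map ratFuncOfInt ≠ 0 :=
    (Polynomial.map_ne_zero_iff ratFuncOfInt_injective).2 hP.ne_zero
  have hi : IsIntegral (RatFunc ℚ) α := isAlgebraic_iff_isIntegral.1 ⟨_, hα0, hα⟩
  let _ : NormalizedGCDMonoid ℤ[X] := Classical.choice inferInstance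
  have hm : minpoly (RatFunc ℚ) α = P.map ratFuncOfInt * C (ratFuncOfInt P.leadingCoeff)⁻¹ :=
    minpoly_eq_map_mul_C (K := RatFunc ℚ) hP hd hα
  have hdeg : Module.finrank (RatFunc ℚ) (RatFunc ℚ)⟮α⟯ = P.natDegree := by
    rw [adjoin.finrank hi, hm, natDegree_mul_C, natDegree_map_eq_of_injective ratFuncOfInt_injective]
    exact inv_ne_zero ((map_ne_zero_iff _ ratFuncOfInt_injective).2 hlc)
  refine ⟨hdeg, ?_⟩
  obtain ⟨i₁, e₁⟩ := integral_archHeight hP.ne_zero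
  obtain ⟨i₂, e₂⟩ := integral_log_absVal hlc
  rw [height, heightIn, integral_congr_ae (Filter.Eventually.of_forall
    (fiberAverage_log_max hP hd hα)), integral_const_mul, integral_sub i₁ i₂, e₁, e₂, sub_zero,
    ← mul_assoc, mul_inv_cancel₀, one_mul]
  rw [hdeg]
  exact_mod_cast hd

/-! ### Irreducible polynomials -/

theorem exists_irreducible_aeval_map_eq_zero {R K Ω : Type} [CommRing R] [IsDomain R]
    [NormalizedGCDMonoid R] [Field K] [Algebra R K] [IsFractionRing R K] [Field Ω] [Algebra K Ω]
    {α : Ω} (hα : IsIntegral K α) :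
    ∃ P : R[X], Irreducible P ∧ P.natDegree ≠ 0 ∧ aeval α (P.map (algebraMap R K)) = 0 := by
  have hinj := IsFractionRing.injective R K
  obtain ⟨b, hb, hbf⟩ := IsLocalization.integerNormalization_spec (nonZeroDivisors R) (minpoly K α)
  set G : R[X] := IsLocalization.integerNormalization (nonZeroDivisors R) (minpoly K α)
  have hb0 : algebraMap R K b ≠ 0 := (map_ne_zero_iff _ hinj).2 (nonZeroDivisors.ne_zero hb)
  have hGf : G.map (algebraMap R K) = C (algebraMap R K b) * minpoly K α := by
    rw [hbf, ← smul_eq_C_mul, algebraMap_smul]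
  have hG0 : G ≠ 0 := by
    intro h
    rw [h, Polynomial.map_zero] at hGf
    exact mul_ne_zero (C_ne_zero.2 hb0) (minpoly.ne_zero hα) hGf.symm
  have hc0 : algebraMap R K G.content ≠ 0 :=
    (map_ne_zero_iff _ hinj).2 (mt content_eq_zero_iff.1 hG0)
  have hPG : C (algebraMap R K G.content) * G.primPart.map (algebraMap R K) =
      C (algebraMap R K b) * minpoly K α := by
    rw [← hGf]
    conv_rhs => rw [G.eq_C_content_mul_primPart]
    simp
  have hassoc : Associated (G.primPart.map (algebraMap R K)) (minpoly K α) :=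
    (associated_unit_mul_left _ _ (isUnit_C.2 hc0.isUnit)).symm.trans
      ((Associated.of_eq hPG).trans (associated_unit_mul_left _ _ (isUnit_C.2 hb0.isUnit)))
  have hirr := hassoc.symm.irreducible (minpoly.irreducible hα)
  refine ⟨G.primPart, (G.isPrimitive_primPart.irreducible_iff_irreducible_map_fraction_map).2 hirr,
    ?_, ?_⟩
  · rw [← natDegree_map_eq_of_injective hinj]
    exact hirr.natDegree_pos.ne'
  · obtain ⟨u, hu⟩ := hassoc.symm
    rw [← hu, map_mul, minpoly.aeval, zero_mul]

/-- `Q` divides `X^n - 1`, which has Mahler measure one, and both factors have nonnegative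
logarithmic measure. -/
theorem logMahler_eq_zero_of_pow_eq_one {Q : ℤ[X]} (hQ : Irreducible Q) (hd : Q.natDegree ≠ 0)
    {Ω : Type} [Field Ω] [Algebra ℚ Ω] {α : Ω} (hα : aeval α Q = 0) {n : ℕ} (hn : 0 < n)
    (h : α ^ n = 1) : logMahler Q = 0 := by
  have hdvd : Q ∣ X ^ n - 1 := by
    rw [IsPrimitive.Int.dvd_iff_map_cast_dvd_map_cast _ _ (hQ.isPrimitive hd)]
    refine Dvd.dvd.trans (b := minpoly ℚ α) ?_ (minpoly.dvd _ _ ?_)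
    · rw [minpoly_eq_map_mul_C (K := ℚ) hQ hd (aeval_map_intCast hα)]
      exact dvd_mul_right _ _
    · simp [h]
  obtain ⟨R, hR⟩ := hdvd
  have h0 : (X ^ n - 1 : ℤ[X]) ≠ 0 := X_pow_sub_C_ne_zero hn 1
  have hR0 : R ≠ 0 := fun h' => h0 (by rw [hR, h', mul_zero])
  have h1 : logMahler (X ^ n - 1) = 0 := by
    have hmap : (X ^ n - 1 : ℤ[X]).map (Int.castRingHom ℂ) = X ^ n - C 1 := by simp
    rw [logMahler, hmap, logMahlerMeasure_eq_log_leadingCoeff_add_sum_log_roots,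
      leadingCoeff_X_pow_sub_C hn, norm_one, Real.log_one, zero_add]
    refine Multiset.sum_eq_zero fun x hx => ?_
    obtain ⟨z, hz, rfl⟩ := Multiset.mem_map.1 hx
    have hz1 : z ^ n = 1 := by
      have := (mem_roots'.1 hz).2
      simpa [sub_eq_zero] using this
    rw [Complex.norm_eq_one_of_pow_eq_one hz1 hn.ne', Real.posLog_eq_zero_iff]
    simp
  rw [hR, logMahler_mul hQ.ne_zero hR0] at h1
  linarith [logMahler_nonneg hQ.ne_zero, logMahler_nonneg hR0]

theorem logMahler_eq_zero_of_coeff_zero_eq_zero {Q : ℤ[X]} (hQ : Irreducible Q) (h : Q.coeff 0 = 0) :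
    logMahler Q = 0 := by
  have h1 : Associated X Q := irreducible_X.associated_of_dvd hQ (X_dvd_iff.2 h)
  rw [← logMahler_eq_of_associated X_ne_zero h1]
  simp [logMahler]

theorem log_two_le_logMahler_of_natDegree_eq_zero {Q : ℤ[X]} (hQ : Irreducible Q)
    (hd : Q.natDegree = 0) : Real.log 2 ≤ logMahler Q := by
  obtain ⟨n, rfl⟩ : ∃ n, Q = C n := ⟨_, eq_C_of_natDegree_eq_zero hd⟩
  have hp : n.natAbs.Prime := Int.prime_iff_natAbs_prime.1 (prime_C_iff.1 hQ.prime)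
  rw [logMahler, map_C, logMahlerMeasure_const]
  apply Real.log_le_log two_pos
  have : (2 : ℝ) ≤ n.natAbs := by exact_mod_cast hp.two_le
  simpa using this

/-- Every algebra structure on `AlgebraicClosure ℚ` over `ℚ` is the canonical one. -/
instance : Algebra.IsAlgebraic ℚ (AlgebraicClosure ℚ) := by
  rw [show (DivisionRing.toRatAlgebra : Algebra ℚ (AlgebraicClosure ℚ)) =
    AlgebraicClosure.instAlgebra ℚ from Subsingleton.elim _ _]
  exact AlgebraicClosure.isAlgebraic ℚ

/-- Kronecker's theorem, transported along an embedding in `ℂ`. -/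
theorem exists_pow_eq_one_of_logMahler_eq_zero {P : ℤ[X]} (hP : P ≠ 0) (h : logMahler P = 0)
    {α : AlgebraicClosure ℚ} (hα : aeval α P = 0) (hα0 : α ≠ 0) : ∃ n : ℕ, 0 < n ∧ α ^ n = 1 := by
  let φ : AlgebraicClosure ℚ →ₐ[ℚ] ℂ := IsAlgClosed.lift
  have hroot : φ α ∈ P.aroots ℂ := by
    rw [mem_aroots]
    refine ⟨hP, ?_⟩
    have := aeval_algHom_apply (φ.restrictScalars ℤ) α P
    rw [hα, map_zero] at this
    exact this
  obtain ⟨n, hn, hn1⟩ := pow_eq_one_of_mahlerMeasure_eq_one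
    (mahlerMeasure_eq_one_of_logMahler_eq_zero hP h) ((map_ne_zero φ).2 hα0) hroot
  exact ⟨n, hn, φ.toRingHom.injective (by
    change φ (α ^ n) = φ 1
    rw [map_pow, hn1, map_one])⟩

/-! ### Constant polynomials -/

/-- Exchanging the variables carries `P.map C` to `C P`, which is prime because `P` is. -/
theorem irreducible_map_C {P : ℤ[X]} (hP : Irreducible P) :
    Irreducible (P.map C : ℤ[X][X]) := by
  have h1 : Prime (C P : ℤ[X][X]) := prime_C_iff.2 hP.prime
  have h2 : Bivariate.swap (R := ℤ) (C P) = P.map C := Bivariate.swap_C P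
  rw [← h2]
  exact ((MulEquiv.prime_iff (Bivariate.swap (R := ℤ)).toMulEquiv).2 h1).irreducible

theorem logMahler₂_map_C (P : ℤ[X]) : logMahler₂ (P.map C) = logMahler P := by
  have h : ∀ x, (specialize (P.map C) x) = P.map (Int.castRingHom ℂ) := fun x => by
    rw [specialize, Polynomial.map_map]
    congr 1
    exact RingHom.ext_int _ _
  simp only [logMahler₂, h]
  rw [Real.circleAverage_const, logMahler]

end AdelicQT

end

/-! ### The equivalence of the two Lehmer problems -/

open AdelicQT in
theorem theorem5p3 :
    (∃ c : ℝ, 0 < c ∧ ∀ α : AlgebraicClosure ℚ, α ≠ 0 → (¬ ∃ n : ℕ, 0 < n ∧ α ^ n = 1) →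
      c / (Module.finrank ℚ ℚ⟮α⟯ : ℝ) ≤ NumberField.absLogHeight₁ α) ↔
    (∃ c : ℝ, 0 < c ∧ ∀ α : AlgebraicClosure (RatFunc ℚ), 0 < AdelicQT.height α →
      c / (Module.finrank (RatFunc ℚ) (RatFunc ℚ)⟮α⟯ : ℝ) ≤ AdelicQT.height α) := by
  let _ : NormalizedGCDMonoid ℤ[X] := Classical.choice inferInstance
  constructor
  · rintro ⟨c, hc, h⟩
    -- Irreducible constants are primes up to sign and lie outside the scope of the hypothesis; they
    -- have measure at least `log 2`, whence the minimum.
    have hgap : ∀ Q : ℤ[X], Irreducible Q → logMahler Q = 0 ∨ min c (Real.log 2) ≤ logMahler Q := by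
      intro Q hQ
      by_cases hd : Q.natDegree = 0
      · exact Or.inr ((min_le_right _ _).trans (log_two_le_logMahler_of_natDegree_eq_zero hQ hd))
      obtain ⟨α, hα⟩ := IsAlgClosed.exists_aeval_eq_zero_of_injective (AlgebraicClosure ℚ)
        (RingHom.injective_int (algebraMap ℤ (AlgebraicClosure ℚ))) Q
        (fun h0 => hd (natDegree_eq_zero_iff_degree_le_zero.2 h0.le))
      by_cases hα0 : α = 0
      · left
        refine logMahler_eq_zero_of_coeff_zero_eq_zero hQ ?_
        rw [hα0, aeval_def, eval₂_at_zero] at hα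
        simpa using hα
      by_cases hu : ∃ n : ℕ, 0 < n ∧ α ^ n = 1
      · obtain ⟨n, hn, hn1⟩ := hu
        exact Or.inl (logMahler_eq_zero_of_pow_eq_one hQ hd hα hn hn1)
      · right
        have hpos : 0 < (Module.finrank ℚ ℚ⟮α⟯ : ℝ) := by
          have : IsIntegral ℚ α := Algebra.IsIntegral.isIntegral α
          rw [adjoin.finrank this]
          exact_mod_cast minpoly.natDegree_pos this
        have := h α hα0 hu
        rw [div_le_iff₀' hpos, finrank_mul_absLogHeight₁ hQ hd hα] at this
        exact (min_le_left _ _).trans this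
    refine ⟨min c (Real.log 2), lt_min hc (Real.log_pos one_lt_two), fun α hα => ?_⟩
    obtain ⟨P, hP, hd, hPα⟩ := exists_irreducible_aeval_map_eq_zero (R := ℤ[X]) (K := RatFunc ℚ)
      (Algebra.IsIntegral.isIntegral (R := RatFunc ℚ) α)
    obtain ⟨hD, hH⟩ := finrank_mul_height hP hd hPα
    have hpos : 0 < (Module.finrank (RatFunc ℚ) (RatFunc ℚ)⟮α⟯ : ℝ) := by
      rw [hD]
      exact_mod_cast Nat.pos_of_ne_zero hd
    rw [div_le_iff₀' hpos, hH]
    exact (logMahler₂_eq_zero_or_le hgap hP.ne_zero).resolve_left (hH ▸ (mul_pos hpos hα).ne')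
  · rintro ⟨c, hc, h⟩
    refine ⟨c, hc, fun α hα0 hα => ?_⟩
    have hint : IsIntegral ℚ α := Algebra.IsIntegral.isIntegral α
    obtain ⟨P, hP, hd, hPα⟩ := exists_irreducible_aeval_map_eq_zero (R := ℤ) (K := ℚ) hint
    rw [aeval_map_algebraMap] at hPα
    have hpos : 0 < (Module.finrank ℚ ℚ⟮α⟯ : ℝ) := by
      rw [adjoin.finrank hint]
      exact_mod_cast minpoly.natDegree_pos hint
    have hM : 0 < logMahler P := (logMahler_nonneg hP.ne_zero).lt_of_ne fun h0 =>
      hα (exists_pow_eq_one_of_logMahler_eq_zero hP.ne_zero h0.symm hPα hα0)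
    have hd' : (P.map C : ℤ[X][X]).natDegree ≠ 0 := by
      rwa [natDegree_map_eq_of_injective C_injective]
    -- A root `β` of the same polynomial over `ℚ(T)`: its degree times its height is again
    -- `logMahler P`, so the constant `c` carries over unchanged.
    obtain ⟨β, hβ⟩ := IsAlgClosed.exists_aeval_eq_zero (AlgebraicClosure (RatFunc ℚ))
      ((P.map C : ℤ[X][X]).map ratFuncOfInt) (fun h0 => hd' (by
        rw [← natDegree_map_eq_of_injective ratFuncOfInt_injective]
        exact natDegree_eq_zero_iff_degree_le_zero.2 h0.le))
    obtain ⟨hD, hH⟩ := finrank_mul_height (irreducible_map_C hP) hd' hβ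
    rw [logMahler₂_map_C] at hH
    have hpos' : 0 < (Module.finrank (RatFunc ℚ) (RatFunc ℚ)⟮β⟯ : ℝ) := by
      rw [hD]
      exact_mod_cast Nat.pos_of_ne_zero hd'
    have h1 := h β (pos_of_mul_pos_right (hH.symm ▸ hM) hpos'.le)
    rw [div_le_iff₀' hpos', hH] at h1
    rw [div_le_iff₀' hpos, finrank_mul_absLogHeight₁ hP hd hPα]
    exact h1
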